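/- **Setting.** Two agents $i,j$ and one good. For $l\in\{i,j\}$, $\alpha_l:\mathbb R_+\to\mathbb R_{++}$ and $u_l:\mathbb R_+\to\mathbb R_+$ are continuous, strictly increasing, strictly concave, $C^2$ on $(0,\infty)$ with $\alpha_l''<0<\alpha_l'$ and $u_l''<0<u_l'$ there; $\alpha_l(0)>0$, $0<\sup_{c>0}\alpha_l(c)<1$, $u_l(0)=0$, $u_l'(0^+)=+\infty$, $u_l'(+\infty)=0$. The production function $f:\mathbb R_+\to\mathbb R_+$ is continuous, strictly increasing, strictly concave, $C^2$ on $(0,\infty)$ with $f''<0<f'$ there, $f(0)=0$, $f'(0^+)>\max\{\alpha_i(0)^{-1},\alpha_j(0)^{-1}\}$, $f'(+\infty)<1$. Agent $l$, taking the consumption sequence $(d_t)$ of the other agent and $k_0$ as given, chooses $(c_t)$ to maximize $\sum_{t\ge0}\big(\prod_{s<t}\alpha_l(c_s)\big)u_l(c_t)$ subject to $k_{t+1}\le f(k_t)-d_t-c_t$, $c_t\ge0$, $k_t\ge0$. A *stationary open-loop equilibrium* is a point $\bar x=(\bar c^i,\bar c^j,\bar k)$ with positive coordinates such that $\bar k=f(\bar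 k)-\bar c^i-\bar c^j$ and the constant sequences $\bar c^i,\bar c^j$ are a Nash equilibrium from $k_0=\bar k$. Let $v_i(k)$ be the supremum of the utility of agent $i$ when $k_0=k$ and the other agent always consumes $\bar c^j$; define $v_j$ symmetrically. For $x=(c^i,c^j,k)$ put $$F^k(x)=f(k)-c^i-c^j,\quad U^l(x)=u_l'(c^l)+\alpha_l'(c^l)v_l(F^k(x)),\quad W^l(x)=u_l''(c^l)+\alpha_l''(c^l)v_l(F^k(x)).$$ The *equilibrium conditions* between consecutive states $x=(c^i,c^j,k)$ and $y=(\hat c^i,\hat c^j,\hat k)$ are $$U^l(x)=\alpha_l(c^l)\,U^l(y)\,f'(\hat k)\quad(l=i,j),\qquad \hat k=F^k(x).$$ An *equilibrium map* is a map $\Phi:\mathbb R^3\to\mathbb R^3$ with $\Phi(\bar x)=\bar x$, continuous at $\bar x$, such that $x$ and $\Phi(x)$ satisfy the equilibrium conditions for all $x$ near $\bar x$. Its *equilibrium paths* are the sequences $x_{t+1}=\Phi(x_t)$ of feasible states ($c^i,c^j,k\ge0$, $k\le f(k)$, $c^i+c^j\le f(k)$) along which the equilibrium conditions hold. At $\bar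 x$ let $$\delta_l=\frac{\alpha_l'}{\alpha_l},\qquad \omega_l=\frac{\alpha_l'}{\alpha_l}-\frac{W^l}{U^l},\qquad \eta_l=\frac{\alpha_l'}{\alpha_l}(f'-1)+\frac{f''}{f'}.$$ **Theorem.** Let $\bar x$ be a stationary open-loop equilibrium such that $v_i,v_j$ are continuously differentiable near $\bar k$. Assume - (P1) $\eta_i<0$ and $\eta_j<0$; - (P2) $\delta_i\le\delta_j$; - (P3) $f'-\big(2\omega_i\omega_j+(\delta_i-\omega_i)\eta_j+\eta_i(\delta_j-\omega_j)\big)\ge0$ at $\bar x$. Then an equilibrium map exists, and every equilibrium map $\Phi$ has the following properties. 1. $\Phi$ is $C^1$ near $\bar x$, and $\bar x$ is a hyperbolic fixed point of $\Phi$: no complex eigenvalue of $D\Phi(\bar x)$ has modulus $1$. 2. Counted with multiplicity, $D\Phi(\bar x)$ has one real eigenvalue $\lambda_1\in(0,1)$ and two complex eigenvalues $\lambda_2,\lambda_3$ of modulus greater than $1$. If all eigenvalues are real, they can be ordered so that $0<\lambda_1<1<\lambda_2\le\lambda_3$, with $\lambda_2<\lambda_3$ if they are distinct. 3. There are an open neighborhood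 $\mathcal N$ of $\bar x$ and a $C^1$ function $\phi:\mathcal N\to\mathbb R^2$ with $\phi(\bar x)=0$, for which $D\phi(\bar x)$ has full rank $2$, and even its $2\times2$ block of partial derivatives with respect to $(c^i,c^j)$ is invertible, such that every equilibrium path $(x_t)$ with $x_0\in\mathcal N$ and $\phi(x_0)=0$ satisfies $\lim_{t\to\infty}x_t=\bar x$. Moreover, for every $x_0\in\mathcal N$ with $\phi(x_0)=0$ the orbit $(\Phi^t(x_0))_{t\ge0}$ is an equilibrium path. -/

import Mathlib

open Filter Topology Set

noncomputable section

namespace Capital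

/-- Recursive preferences of one agent: an instantaneous utility `u` and a consumption-dependent
discount factor `α`, both used on `[0, ∞)` only. -/
structure Preferences where
  u : ℝ → ℝ
  α : ℝ → ℝ
  α_cont : ContinuousOn α (Ici 0)
  α_mono : StrictMonoOn α (Ici 0)
  α_concave : StrictConcaveOn ℝ (Ici 0) α
  α_smooth : ContDiffOn ℝ 2 α (Ioi 0)
  α_deriv_pos : ∀ c, 0 < c → 0 < deriv α c
  α_deriv2_neg : ∀ c, 0 < c → deriv (deriv α) c < 0
  α_zero_pos : 0 < α 0
  α_sup : ∃ s, 0 < s ∧ s < 1 ∧ IsLUB (α '' Ioi 0) s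
  u_cont : ContinuousOn u (Ici 0)
  u_mono : StrictMonoOn u (Ici 0)
  u_concave : StrictConcaveOn ℝ (Ici 0) u
  u_smooth : ContDiffOn ℝ 2 u (Ioi 0)
  u_deriv_pos : ∀ c, 0 < c → 0 < deriv u c
  u_deriv2_neg : ∀ c, 0 < c → deriv (deriv u) c < 0
  u_zero : u 0 = 0
  u_inada_zero : Tendsto (deriv u) (𝓝[>] 0) atTop
  u_inada_top : Tendsto (deriv u) atTop (𝓝 0)

/-- Two agents `i`, `j` and a neoclassical production function `f`, used on `[0, ∞)` only.
The limit of `f'` at `0` may be `+∞`, so it is taken in the extended reals. -/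
structure Economy where
  prefI : Preferences
  prefJ : Preferences
  f : ℝ → ℝ
  f_cont : ContinuousOn f (Ici 0)
  f_mono : StrictMonoOn f (Ici 0)
  f_concave : StrictConcaveOn ℝ (Ici 0) f
  f_smooth : ContDiffOn ℝ 2 f (Ioi 0)
  f_deriv_pos : ∀ k, 0 < k → 0 < deriv f k
  f_deriv2_neg : ∀ k, 0 < k → deriv (deriv f) k < 0
  f_zero : f 0 = 0
  f_deriv_zero : ∃ L : EReal, Tendsto (fun k : ℝ => ((deriv f k : ℝ) : EReal)) (𝓝[>] 0) (𝓝 L) ∧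
    ((max (prefI.α 0)⁻¹ (prefJ.α 0)⁻¹ : ℝ) : EReal) < L
  f_deriv_top : ∃ L : ℝ, Tendsto (deriv f) atTop (𝓝 L) ∧ L < 1

/-- A state `(cⁱ, cʲ, k)` is stored as `x 0 = cⁱ`, `x 1 = cʲ`, `x 2 = k`. -/
abbrev State := Fin 3 → ℝ

/-- Prospective utility `∑ₜ (∏_{s < t} α(cₛ)) u(cₜ)` of a consumption sequence. -/
def prospectiveUtility (P : Preferences) (c : ℕ → ℝ) : ℝ :=
  ∑' t, (∏ s ∈ Finset.range t, P.α (c s)) * P.u (c t)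

/-- The consumption sequence `c` is feasible from the aggregate capital stock `k₀` when the rival
consumes `d`. -/
def IsFeasible (f : ℝ → ℝ) (d : ℕ → ℝ) (k₀ : ℝ) (c : ℕ → ℝ) : Prop :=
  ∃ k : ℕ → ℝ, k 0 = k₀ ∧ ∀ t, 0 ≤ c t ∧ 0 ≤ k t ∧ k (t + 1) ≤ f (k t) - d t - c t

/-- The value function of an agent with preferences `P` whose rival consumes the constant
amount `d`: the supremum of prospective utility over all sequences feasible from `k`. -/
def valueFn (P : Preferences) (f : ℝ → ℝ) (d k : ℝ) : ℝ :=
  sSup (prospectiveUtility P '' {c | IsFeasible f (fun _ => d) k c})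

namespace Economy

variable (E : Economy)

/-- Nash equilibrium in open-loop (precommitment) strategies from aggregate capital `k₀`. -/
def IsOpenLoopNash (k₀ : ℝ) (ci cj : ℕ → ℝ) : Prop :=
  (IsFeasible E.f cj k₀ ci ∧
    ∀ c, IsFeasible E.f cj k₀ c → prospectiveUtility E.prefI c ≤ prospectiveUtility E.prefI ci) ∧
  (IsFeasible E.f ci k₀ cj ∧
    ∀ c, IsFeasible E.f ci k₀ c → prospectiveUtility E.prefJ c ≤ prospectiveUtility E.prefJ cj)

/-- An interior stationary open-loop equilibrium: a positive, time-independent allocation that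
reproduces the capital stock and whose constant consumption sequences form a Nash equilibrium. -/
def IsStationaryEquilibrium (xb : State) : Prop :=
  (∀ l, 0 < xb l) ∧ xb 2 = E.f (xb 2) - xb 0 - xb 1 ∧
    E.IsOpenLoopNash (xb 2) (fun _ => xb 0) (fun _ => xb 1)

/-- The value functions of the two agents at the stationary equilibrium `xb`: each takes the
stationary consumption of the other one as given. -/
def vI (xb : State) (k : ℝ) : ℝ := valueFn E.prefI E.f (xb 1) k

/-- The same for agent `j`. -/
def vJ (xb : State) (k : ℝ) : ℝ := valueFn E.prefJ E.f (xb 0) k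

/-- Next period's capital stock `f(k) - cⁱ - cʲ`. -/
def Fk (x : State) : ℝ := E.f (x 2) - x 0 - x 1

/-- `Uⁱ = uᵢ'(cⁱ) + αᵢ'(cⁱ) vᵢ(f(k) - cⁱ - cʲ)`, and likewise `Uʲ`. -/
def UI (xb x : State) : ℝ :=
  deriv E.prefI.u (x 0) + deriv E.prefI.α (x 0) * E.vI xb (E.Fk x)

/-- The same for agent `j`. -/
def UJ (xb x : State) : ℝ :=
  deriv E.prefJ.u (x 1) + deriv E.prefJ.α (x 1) * E.vJ xb (E.Fk x)

/-- `Wⁱ = uᵢ''(cⁱ) + αᵢ''(cⁱ) vᵢ(f(k) - cⁱ - cʲ)`, and likewise `Wʲ`. -/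
def WI (xb x : State) : ℝ :=
  deriv (deriv E.prefI.u) (x 0) + deriv (deriv E.prefI.α) (x 0) * E.vI xb (E.Fk x)

/-- The same for agent `j`. -/
def WJ (xb x : State) : ℝ :=
  deriv (deriv E.prefJ.u) (x 1) + deriv (deriv E.prefJ.α) (x 1) * E.vJ xb (E.Fk x)

/-- The equilibrium conditions linking the state `x` today with the state `y` tomorrow. -/
def EquilibriumStep (xb x y : State) : Prop :=
  E.UI xb x = E.prefI.α (x 0) * E.UI xb y * deriv E.f (y 2) ∧
  E.UJ xb x = E.prefJ.α (x 1) * E.UJ xb y * deriv E.f (y 2) ∧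
  y 2 = E.Fk x

/-- `Φ` is (a version of) the map implicitly defined near the stationary equilibrium `xb` by the
equilibrium conditions. -/
def IsEquilibriumMap (xb : State) (Φ : State → State) : Prop :=
  Φ xb = xb ∧ ContinuousAt Φ xb ∧ ∀ᶠ x in 𝓝 xb, E.EquilibriumStep xb x (Φ x)

/-- Feasible states. For `k ≥ 0`, the condition `k ≤ f k` says that `k` does not exceed the
maximum sustainable capital level. -/
def stateSpace : Set State :=
  {x | 0 ≤ x 0 ∧ 0 ≤ x 1 ∧ 0 ≤ x 2 ∧ x 2 ≤ E.f (x 2) ∧ x 0 + x 1 ≤ E.f (x 2)}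

/-- Equilibrium paths: feasible orbits of `Φ` along which the equilibrium conditions hold. -/
def IsEquilibriumPath (xb : State) (Φ : State → State) (x : ℕ → State) : Prop :=
  ∀ t, x t ∈ E.stateSpace ∧ x (t + 1) = Φ (x t) ∧ E.EquilibriumStep xb (x t) (x (t + 1))

/-- `δ = α'/α` at the stationary equilibrium. -/
def δI (xb : State) : ℝ := deriv E.prefI.α (xb 0) / E.prefI.α (xb 0)

/-- The same for agent `j`. -/
def δJ (xb : State) : ℝ := deriv E.prefJ.α (xb 1) / E.prefJ.α (xb 1)

/-- `ω = α'/α - W/U` at the stationary equilibrium. -/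
def ωI (xb : State) : ℝ := E.δI xb - E.WI xb xb / E.UI xb xb

/-- The same for agent `j`. -/
def ωJ (xb : State) : ℝ := E.δJ xb - E.WJ xb xb / E.UJ xb xb

/-- `η = (α'/α) (f' - 1) + f''/f'` at the stationary equilibrium. -/
def ηI (xb : State) : ℝ :=
  E.δI xb * (deriv E.f (xb 2) - 1) + deriv (deriv E.f) (xb 2) / deriv E.f (xb 2)

/-- The same for agent `j`. -/
def ηJ (xb : State) : ℝ :=
  E.δJ xb * (deriv E.f (xb 2) - 1) + deriv (deriv E.f) (xb 2) / deriv E.f (xb 2)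

end Economy

/-- The Jacobian matrix of `Φ` at `x`. -/
def jacobian (Φ : State → State) (x : State) : Matrix (Fin 3) (Fin 3) ℝ :=
  LinearMap.toMatrix' (fderiv ℝ Φ x : State →ₗ[ℝ] State)

/-- A hyperbolic fixed point: the Jacobian matrix has no complex eigenvalue of modulus one. -/
def IsHyperbolicFixedPoint (Φ : State → State) (x : State) : Prop :=
  Φ x = x ∧ DifferentiableAt ℝ Φ x ∧
    ∀ z ∈ spectrum ℂ ((jacobian Φ x).map (algebraMap ℝ ℂ)), ‖z‖ ≠ 1

/-- The matrix of the partial derivatives of `φ` with respect to `cⁱ` and `cʲ`. -/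
def consumptionJacobian (φ : State → Fin 2 → ℝ) (x : State) : Matrix (Fin 2) (Fin 2) ℝ :=
  Matrix.of fun l m => fderiv ℝ φ x (Pi.single m.castSucc 1) l

end Capital

end

/-! Two one-period deviations determine the data at the stationary state. Consuming `h` more and
leaving `k - h` gives `U = α v'`; starting from a nearby stock and returning to `k` at once gives
`v' = U f'` (`first_order_conditions`). Hence `α f' = 1`, so `R = f' > 1` because `α < 1`, and `U >
0 > W` gives `0 < δ < ω` for each agent.

Linearizing the equilibrium conditions gives `A D = B` for the derivative `D` of an equilibrium map,
with `det A = ωi ωj - δi δj > 0`. The implicit function theorem therefore produces a `C¹` map with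
which every equilibrium map agrees near the fixed point, and the characteristic polynomial is `q(x)
= det (x A - B) / det A`. Negative `η` yields `q(0) < -1`, `q(1) > 0` and `q < 0` on the nonpositive
axis (`exists_roots`). So `q` has a root in `(0, 1)`. The product of the other two roots exceeds
one, and they are either conjugate or real, positive and on the same side of `1`: both lie outside
the unit circle.

The stable manifold comes from Irwin's method. Orbits tending to the fixed point are zeros of a `C¹`
map on a Banach space of null sequences, and the inverse function theorem applies once `h (t + 1) =
D (h t) + g t` has exactly one null solution with prescribed initial capital
(`exists_unique_stable_orbit`). Existence follows from scalar recurrences and Cayley–Hamilton.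
Uniqueness holds because null orbits of `D` start in the eigenspace of the root in `(0, 1)`, on
which the capital coordinate is injective. The stable curve is thus a graph over capital, and `φ` is
consumption minus its value on the curve. -/

namespace Capital

/-! ### Discounted utilities, the Bellman inequality and first order conditions -/

namespace Preferences

variable (P : Preferences)

theorem α_pos {c : ℝ} (hc : 0 ≤ c) : 0 < P.α c := by
  rcases hc.eq_or_lt with rfl | h
  · exact P.α_zero_pos
  · exact P.α_zero_pos.trans (P.α_mono self_mem_Ici hc h)

theorem exists_α_le : ∃ s, 0 < s ∧ s < 1 ∧ ∀ c, 0 ≤ c → P.α c ≤ s := by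
  obtain ⟨s, hs0, hs1, hs⟩ := P.α_sup
  refine ⟨s, hs0, hs1, fun c hc => ?_⟩
  -- The supremum runs over positive consumption only; the shift by one also covers `c = 0`.
  have h1 : P.α (c + 1) ≤ s := hs.1 ⟨c + 1, by simp only [mem_Ioi]; linarith, rfl⟩
  exact (P.α_mono hc (by simp only [mem_Ici]; linarith) (by linarith)).le.trans h1

theorem u_nonneg {c : ℝ} (hc : 0 ≤ c) : 0 ≤ P.u c := by
  have := P.u_mono.monotoneOn self_mem_Ici hc hc
  rwa [P.u_zero] at this

theorem hasDerivAt_u {c : ℝ} (hc : 0 < c) : HasDerivAt P.u (deriv P.u c) c :=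
  ((P.u_smooth.contDiffAt (Ioi_mem_nhds hc)).differentiableAt (by norm_num)).hasDerivAt

theorem hasDerivAt_α {c : ℝ} (hc : 0 < c) : HasDerivAt P.α (deriv P.α c) c :=
  ((P.α_smooth.contDiffAt (Ioi_mem_nhds hc)).differentiableAt (by norm_num)).hasDerivAt

/-- A bounded consumption sequence has summable discounted utilities, with a uniform bound. -/
theorem exists_prospectiveUtility_le (C : ℝ) : ∃ B, ∀ c : ℕ → ℝ, (∀ t, 0 ≤ c t ∧ c t ≤ C) →
    Summable (fun t => (∏ s ∈ Finset.range t, P.α (c s)) * P.u (c t)) ∧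
      prospectiveUtility P c ≤ B := by
  obtain ⟨s, hs0, hs1, hs⟩ := P.exists_α_le
  refine ⟨∑' t : ℕ, s ^ t * P.u C, fun c hc => ?_⟩
  have hsum : Summable fun t : ℕ => s ^ t * P.u C :=
    (summable_geometric_of_lt_one hs0.le hs1).mul_right _
  have hle (t : ℕ) : (∏ s ∈ Finset.range t, P.α (c s)) * P.u (c t) ≤ s ^ t * P.u C := by
    refine mul_le_mul ?_ (P.u_mono.monotoneOn (hc t).1 ((hc t).1.trans (hc t).2) (hc t).2)
      (P.u_nonneg (hc t).1) (by positivity)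
    calc ∏ s ∈ Finset.range t, P.α (c s) ≤ ∏ _s ∈ Finset.range t, s :=
          Finset.prod_le_prod (fun i _ => (P.α_pos (hc i).1).le) fun i _ => hs _ (hc i).1
      _ = s ^ t := by simp
  have hnn (t : ℕ) : 0 ≤ (∏ s ∈ Finset.range t, P.α (c s)) * P.u (c t) :=
    mul_nonneg (Finset.prod_nonneg fun i _ => (P.α_pos (hc i).1).le) (P.u_nonneg (hc t).1)
  have hsm := Summable.of_nonneg_of_le hnn hle hsum
  exact ⟨hsm, hsm.tsum_le_tsum hle hsum⟩

theorem prospectiveUtility_nonneg {c : ℕ → ℝ} (hc : ∀ t, 0 ≤ c t) :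
    0 ≤ prospectiveUtility P c :=
  tsum_nonneg fun t =>
    mul_nonneg (Finset.prod_nonneg fun i _ => (P.α_pos (hc i)).le) (P.u_nonneg (hc t))

theorem prospectiveUtility_eq {c : ℕ → ℝ}
    (hc : Summable fun t => (∏ s ∈ Finset.range t, P.α (c s)) * P.u (c t)) :
    prospectiveUtility P c =
      P.u (c 0) + P.α (c 0) * prospectiveUtility P (fun t => c (t + 1)) := by
  unfold prospectiveUtility
  rw [hc.tsum_eq_zero_add, ← tsum_mul_left]
  simp only [Finset.range_zero, Finset.prod_empty, one_mul, Finset.prod_range_succ']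
  congr 1
  exact tsum_congr fun t => by ring

end Preferences

namespace Economy

variable (E : Economy)

theorem hasDerivAt_f {k : ℝ} (hk : 0 < k) : HasDerivAt E.f (deriv E.f k) k :=
  ((E.f_smooth.contDiffAt (Ioi_mem_nhds hk)).differentiableAt (by norm_num)).hasDerivAt

theorem f_nonneg {k : ℝ} (hk : 0 ≤ k) : 0 ≤ E.f k := by
  have := E.f_mono.monotoneOn self_mem_Ici hk hk
  rwa [E.f_zero] at this

/-- Production lies below an affine function of slope less than one. -/
theorem exists_f_le : ∃ A B, 0 < A ∧ A < 1 ∧ 0 ≤ B ∧ ∀ k, 0 ≤ k → E.f k ≤ A * k + B := by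
  obtain ⟨L, hL, hL1⟩ := E.f_deriv_top
  obtain ⟨m, hm0, hm1⟩ := ((eventually_gt_atTop (0 : ℝ)).and (hL.eventually_lt_const hL1)).exists
  -- At a point `m` with `f'(m) < 1`, the line of slope `f'(m)` and intercept `f(m)` dominates `f`:
  -- by monotonicity up to `m`, by the tangent inequality beyond.
  refine ⟨deriv E.f m, E.f m, E.f_deriv_pos m hm0, hm1, E.f_nonneg hm0.le, fun k hk => ?_⟩
  have hp := E.f_deriv_pos m hm0
  rcases le_or_gt k m with h | h
  · have := E.f_mono.monotoneOn hk hm0.le h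
    have := mul_nonneg hp.le hk
    linarith
  · have h1 := E.f_concave.concaveOn.slope_le_of_hasDerivAt hm0.le hk h (E.hasDerivAt_f hm0)
    rw [slope_def_field, div_le_iff₀ (by linarith)] at h1
    have := mul_pos hp hm0
    linarith

/-- Consumption along feasible sequences is bounded by a constant depending on the initial
capital stock only. -/
theorem exists_feasible_le {d : ℝ} (hd : 0 ≤ d) (k₀ : ℝ) :
    ∃ C, ∀ c, IsFeasible E.f (fun _ => d) k₀ c → ∀ t, 0 ≤ c t ∧ c t ≤ C := by
  obtain ⟨A, B, hA0, hA1, hB, hf⟩ := E.exists_f_le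
  -- Above the fixed point `B / (1 - A)` of `k ↦ A k + B`, this map does not increase `M`, so
  -- capital never exceeds `M`.
  set M := max k₀ (B / (1 - A)) with hM
  have hMB : A * M + B ≤ M := by
    have h := le_max_right k₀ (B / (1 - A))
    rw [← hM, div_le_iff₀ (by linarith)] at h
    linarith
  refine ⟨M, fun c ⟨k, hk0, hk⟩ => ?_⟩
  have hkM (t : ℕ) : k t ≤ M := by
    induction t with
    | zero => rw [hk0]; exact le_max_left _ _
    | succ t ih =>
      have h1 := hf _ (hk t).2.1
      have h2 := mul_le_mul_of_nonneg_left ih hA0.le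
      linarith [(hk t).2.2, (hk t).1]
  intro t
  have h1 := hf _ (hk t).2.1
  have h2 := mul_le_mul_of_nonneg_left (hkM t) hA0.le
  exact ⟨(hk t).1, by linarith [(hk t).2.2, (hk (t + 1)).2.1]⟩

theorem summable_of_isFeasible (P : Preferences) {d k₀ : ℝ} (hd : 0 ≤ d) {c : ℕ → ℝ}
    (hc : IsFeasible E.f (fun _ => d) k₀ c) :
    Summable (fun t => (∏ s ∈ Finset.range t, P.α (c s)) * P.u (c t)) := by
  obtain ⟨C, hC⟩ := E.exists_feasible_le hd k₀
  obtain ⟨B, hB⟩ := P.exists_prospectiveUtility_le C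
  exact (hB c (hC c hc)).1

theorem bddAbove_prospectiveUtility (P : Preferences) {d : ℝ} (hd : 0 ≤ d) (k₀ : ℝ) :
    BddAbove (prospectiveUtility P '' {c | IsFeasible E.f (fun _ => d) k₀ c}) := by
  obtain ⟨C, hC⟩ := E.exists_feasible_le hd k₀
  obtain ⟨B, hB⟩ := P.exists_prospectiveUtility_le C
  refine ⟨B, ?_⟩
  rintro _ ⟨c, hc, rfl⟩
  exact (hB c (hC c hc)).2

/-- The Bellman inequality. -/
theorem le_valueFn (P : Preferences) {d : ℝ} (hd : 0 ≤ d) {k k' c : ℝ} (hk : 0 ≤ k) (hc : 0 ≤ c)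
    (hk' : k' ≤ E.f k - d - c) (hne : ∃ c, IsFeasible E.f (fun _ => d) k' c) :
    P.u c + P.α c * valueFn P E.f d k' ≤ valueFn P E.f d k := by
  have hα := P.α_pos hc
  suffices h : valueFn P E.f d k' ≤ (valueFn P E.f d k - P.u c) / P.α c by
    rw [le_div_iff₀ hα] at h
    linarith
  obtain ⟨c₁, hc₁⟩ := hne
  refine csSup_le ⟨_, c₁, hc₁, rfl⟩ ?_
  rintro _ ⟨c', hc', rfl⟩
  rw [le_div_iff₀ hα]
  -- Prepending `c` to a plan feasible from `k'` gives a plan feasible from `k`.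
  have hf : IsFeasible E.f (fun _ => d) k (fun t => Nat.casesOn t c c') := by
    obtain ⟨κ, h0, h1⟩ := hc'
    refine ⟨fun t => Nat.casesOn t k κ, rfl, fun t => ?_⟩
    cases t with
    | zero => exact ⟨hc, hk, by simpa [h0] using hk'⟩
    | succ t => exact h1 t
  have h1 := le_csSup (E.bddAbove_prospectiveUtility P hd k) ⟨_, hf, rfl⟩
  rw [P.prospectiveUtility_eq (E.summable_of_isFeasible P hd hf)] at h1
  change P.u c + P.α c * prospectiveUtility P c' ≤ valueFn P E.f d k at h1
  linarith

/-- No feasible sequence is needed: the real supremum of the empty set is `0`. -/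
theorem valueFn_nonneg (P : Preferences) (d k : ℝ) : 0 ≤ valueFn P E.f d k := by
  apply Real.sSup_nonneg
  rintro _ ⟨c, ⟨κ, _, h⟩, rfl⟩
  exact P.prospectiveUtility_nonneg fun t => (h t).1

/-- First order conditions of an agent at a stationary optimum with differentiable value
function: `U = α v'` and the envelope condition `v' = U f'`. -/
theorem first_order_conditions (P : Preferences) {d c k : ℝ} (hd : 0 < d) (hc : 0 < c) (hk : 0 < k)
    (hstat : k = E.f k - d - c)
    (hopt : ∀ c', IsFeasible E.f (fun _ => d) k c' →
      prospectiveUtility P c' ≤ prospectiveUtility P (fun _ => c))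
    (hv : DifferentiableAt ℝ (valueFn P E.f d) k) :
    deriv P.u c + deriv P.α c * valueFn P E.f d k = P.α c * deriv (valueFn P E.f d) k ∧
    deriv (valueFn P E.f d) k =
      (deriv P.u c + deriv P.α c * valueFn P E.f d k) * deriv E.f k := by
  set v := valueFn P E.f d with hvdef
  have hfeas : IsFeasible E.f (fun _ => d) k (fun _ => c) :=
    ⟨fun _ => k, rfl, fun _ => ⟨hc.le, hk.le, hstat.le⟩⟩
  have hvk : v k = prospectiveUtility P (fun _ => c) :=
    IsGreatest.csSup_eq ⟨⟨_, hfeas, rfl⟩, by rintro _ ⟨c', hc', rfl⟩; exact hopt c' hc'⟩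
  have hrec : v k = P.u c + P.α c * v k := by
    rw [hvk]
    exact P.prospectiveUtility_eq (E.summable_of_isFeasible P hd.le hfeas)
  have hcont : ContinuousAt E.f k := (E.hasDerivAt_f hk).continuousAt
  have hpos : ∀ᶠ κ in 𝓝 k, 0 < κ ∧ 0 < c + (E.f κ - E.f k) := by
    refine (eventually_gt_nhds hk).and ?_
    have : Tendsto (fun κ => c + (E.f κ - E.f k)) (𝓝 k) (𝓝 (c + (E.f k - E.f k))) :=
      (hcont.sub continuousAt_const).const_add c
    rw [sub_self, add_zero] at this
    exact this.eventually_const_lt hc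
  -- The first consumption absorbs the change in output, so that capital is back at `k` after one
  -- period.
  have hne : ∀ᶠ κ in 𝓝 k, ∃ c, IsFeasible E.f (fun _ => d) κ c := by
    filter_upwards [hpos] with κ hκ
    refine ⟨fun t => Nat.casesOn t (c + (E.f κ - E.f k)) fun _ => c,
      fun t => Nat.casesOn t κ fun _ => k, rfl, fun t => ?_⟩
    cases t with
    | zero =>
      refine ⟨hκ.2.le, hκ.1.le, ?_⟩
      change k ≤ E.f κ - d - (c + (E.f κ - E.f k))
      linarith
    | succ t => exact ⟨hc.le, hk.le, hstat.le⟩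
  constructor
  -- Consuming `h` more today leaves `k - h`. By the Bellman inequality the payoff is maximal at `h
  -- = 0`.
  · have hsub : HasDerivAt (fun h : ℝ => k - h) (-1) 0 := by
      simpa using (hasDerivAt_id (0 : ℝ)).const_sub k
    have hadd : HasDerivAt (fun h : ℝ => c + h) 1 0 := by
      simpa using (hasDerivAt_id (0 : ℝ)).const_add c
    have hg : HasDerivAt (fun h => P.u (c + h) + P.α (c + h) * v (k - h))
        (deriv P.u c + (deriv P.α c * v k + P.α c * -deriv v k)) 0 := by
      have h1 : HasDerivAt (fun h => P.u (c + h)) (deriv P.u c * 1) 0 :=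
        HasDerivAt.comp (h₂ := P.u) 0 (by simpa using P.hasDerivAt_u hc) hadd
      have h2 : HasDerivAt (fun h => P.α (c + h)) (deriv P.α c * 1) 0 :=
        HasDerivAt.comp (h₂ := P.α) 0 (by simpa using P.hasDerivAt_α hc) hadd
      have h3 : HasDerivAt (fun h => v (k - h)) (deriv v k * -1) 0 :=
        HasDerivAt.comp (h₂ := v) 0 (by simpa using hv.hasDerivAt) hsub
      refine (h1.add (h2.mul h3)).congr_deriv ?_
      simp only [add_zero, sub_zero]
      ring
    have hmax : IsLocalMax (fun h => P.u (c + h) + P.α (c + h) * v (k - h)) 0 := by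
      have h1 : ∀ᶠ h in 𝓝 (0 : ℝ), 0 < c + h :=
        hadd.continuousAt.eventually_const_lt (by simpa using hc)
      have h2 : ∀ᶠ h in 𝓝 (0 : ℝ), ∃ c, IsFeasible E.f (fun _ => d) (k - h) c := by
        have := hsub.continuousAt.tendsto
        rw [sub_zero] at this
        exact this.eventually hne
      filter_upwards [h1, h2] with h hh1 hh2
      simp only [add_zero, sub_zero]
      rw [← hrec]
      exact E.le_valueFn P hd.le hk.le hh1.le (by linarith) hh2
    have := hmax.hasDerivAt_eq_zero hg
    linarith
  -- Envelope argument: from `κ`, consumption is adjusted to reach `k` tomorrow. The value at `κ`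
  -- minus this payoff is nonnegative and vanishes at `κ = k`.
  · have hfd : HasDerivAt (fun κ => c + (E.f κ - E.f k)) (deriv E.f k) k :=
      ((E.hasDerivAt_f hk).sub_const _).const_add c
    have hg : HasDerivAt (fun κ => v κ - (P.u (c + (E.f κ - E.f k)) +
        P.α (c + (E.f κ - E.f k)) * v k))
        (deriv v k - (deriv P.u c * deriv E.f k + deriv P.α c * deriv E.f k * v k)) k := by
      have h1 : HasDerivAt (fun κ => P.u (c + (E.f κ - E.f k))) (deriv P.u c * deriv E.f k) k :=
        HasDerivAt.comp (h₂ := P.u) k (by simpa using P.hasDerivAt_u hc) hfd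
      have h2 : HasDerivAt (fun κ => P.α (c + (E.f κ - E.f k))) (deriv P.α c * deriv E.f k) k :=
        HasDerivAt.comp (h₂ := P.α) k (by simpa using P.hasDerivAt_α hc) hfd
      exact hv.hasDerivAt.sub (h1.add (h2.mul_const _))
    have hmin : IsLocalMin (fun κ => v κ - (P.u (c + (E.f κ - E.f k)) +
        P.α (c + (E.f κ - E.f k)) * v k)) k := by
      filter_upwards [hpos] with κ hκ
      simp only [sub_self, add_zero]
      rw [← hrec, sub_self, sub_nonneg]
      exact E.le_valueFn P hd.le hκ.1.le hκ.2.le (by linarith) ⟨_, hfeas⟩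
    have := hmin.hasDerivAt_eq_zero hg
    linarith

end Economy

end Capital

namespace Capital

/-! ### Linear recurrences -/

/-- The solution starting at `0` is the convolution of `g` with a summable geometric sequence, so
dominated convergence applies. -/
theorem exists_tendsto_zero_recurrence_of_norm_lt_one {l : ℂ} (hl : ‖l‖ < 1) {g : ℕ → ℂ}
    (hg : Tendsto g atTop (𝓝 0)) :
    ∃ h : ℕ → ℂ, Tendsto h atTop (𝓝 0) ∧ ∀ t, h (t + 1) = l * h t + g t := by
  obtain ⟨C, hC⟩ := hg.norm.bddAbove_range
  have hC' (t : ℕ) : ‖g t‖ ≤ C := hC ⟨t, rfl⟩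
  have hC0 : 0 ≤ C := (norm_nonneg _).trans (hC' 0)
  -- The truncated subtraction is exact, since `n < t` in the sum.
  refine ⟨fun t => ∑ n ∈ Finset.range t, l ^ n * g (t - 1 - n), ?_, fun t => ?_⟩
  · have key : Tendsto (fun t => ∑' n, if n < t then l ^ n * g (t - 1 - n) else 0) atTop
        (𝓝 (∑' _n : ℕ, (0 : ℂ))) := by
      refine tendsto_tsum_of_dominated_convergence (bound := fun n => ‖l‖ ^ n * C)
        ((summable_geometric_of_lt_one (norm_nonneg l) hl).mul_right C) (fun n => ?_)
        (Eventually.of_forall fun t n => ?_)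
      · have h1 : Tendsto (fun t : ℕ => t - 1 - n) atTop atTop :=
          (tendsto_sub_atTop_nat n).comp (tendsto_sub_atTop_nat 1)
        have h2 : Tendsto (fun t => l ^ n * g (t - 1 - n)) atTop (𝓝 0) := by
          simpa using (hg.comp h1).const_mul (l ^ n)
        refine h2.congr' ?_
        filter_upwards [eventually_gt_atTop n] with t ht
        rw [if_pos ht]
      · split_ifs
        · rw [norm_mul, norm_pow]
          gcongr
          exact hC' _
        · rw [norm_zero]
          positivity
    rw [tsum_zero] at key
    refine key.congr fun t => ?_
    rw [tsum_eq_sum (s := Finset.range t) fun n hn => if_neg (by simpa using hn)]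
    exact Finset.sum_congr rfl fun n hn => if_pos (by simpa using hn)
  · simp only
    rw [Finset.sum_range_succ', Finset.mul_sum]
    congr 1
    · refine Finset.sum_congr rfl fun n _ => ?_
      rw [show t + 1 - 1 - (n + 1) = t - 1 - n by omega]
      ring
    · simp

/-- An expanding recurrence is solved backward from infinity, by a geometric series in `l⁻¹` over
the future values of `g`. -/
theorem exists_tendsto_zero_recurrence_of_one_lt_norm {l : ℂ} (hl : 1 < ‖l‖) {g : ℕ → ℂ}
    (hg : Tendsto g atTop (𝓝 0)) :
    ∃ h : ℕ → ℂ, Tendsto h atTop (𝓝 0) ∧ ∀ t, h (t + 1) = l * h t + g t := by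
  obtain ⟨C, hC⟩ := hg.norm.bddAbove_range
  have hC' (t : ℕ) : ‖g t‖ ≤ C := hC ⟨t, rfl⟩
  have hl0 : l ≠ 0 := norm_pos_iff.1 (one_pos.trans hl)
  have hinv : ‖l⁻¹‖ < 1 := by
    rw [norm_inv]
    exact inv_lt_one_of_one_lt₀ hl
  have hb : Summable fun n : ℕ => ‖l⁻¹‖ ^ (n + 1) * C :=
    ((summable_nat_add_iff 1).2 (summable_geometric_of_lt_one (norm_nonneg _) hinv)).mul_right C
  have hle (t n : ℕ) : ‖l⁻¹ ^ (n + 1) * g (t + n)‖ ≤ ‖l⁻¹‖ ^ (n + 1) * C := by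
    rw [norm_mul, norm_pow]
    gcongr
    exact hC' _
  refine ⟨fun t => -∑' n, l⁻¹ ^ (n + 1) * g (t + n), ?_, fun t => ?_⟩
  · have key : Tendsto (fun t => ∑' n, l⁻¹ ^ (n + 1) * g (t + n)) atTop
        (𝓝 (∑' _n : ℕ, (0 : ℂ))) := by
      refine tendsto_tsum_of_dominated_convergence hb (fun n => ?_)
        (Eventually.of_forall fun t n => hle t n)
      simpa using (hg.comp (tendsto_add_atTop_nat n)).const_mul (l⁻¹ ^ (n + 1))
    simpa using key.neg
  · simp only
    rw [(Summable.of_norm_bounded hb (hle t)).tsum_eq_zero_add, mul_neg, mul_add, ← tsum_mul_left]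
    have h1 (n : ℕ) : l * (l⁻¹ ^ (n + 1 + 1) * g (t + (n + 1))) =
        l⁻¹ ^ (n + 1) * g (t + 1 + n) := by
      rw [pow_succ l⁻¹ (n + 1), show t + (n + 1) = t + 1 + n by ring]
      field_simp
    simp only [h1]
    simp [hl0]

theorem exists_tendsto_zero_recurrence {l : ℂ} (hl : ‖l‖ ≠ 1) {g : ℕ → ℂ}
    (hg : Tendsto g atTop (𝓝 0)) :
    ∃ h : ℕ → ℂ, Tendsto h atTop (𝓝 0) ∧ ∀ t, h (t + 1) = l * h t + g t :=
  hl.lt_or_gt.elim (fun h => exists_tendsto_zero_recurrence_of_norm_lt_one h hg)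
    fun h => exists_tendsto_zero_recurrence_of_one_lt_norm h hg

/-- A real third order recurrence without characteristic root on the unit circle has a solution
tending to zero for each right-hand side tending to zero. -/
theorem exists_tendsto_zero_cubic_recurrence {a b c : ℝ} {l₁ l₂ l₃ : ℂ}
    (ha : (a : ℂ) = -(l₁ + l₂ + l₃)) (hb : (b : ℂ) = l₁ * l₂ + l₁ * l₃ + l₂ * l₃)
    (hc : (c : ℂ) = -(l₁ * l₂ * l₃)) (h₁ : ‖l₁‖ ≠ 1) (h₂ : ‖l₂‖ ≠ 1) (h₃ : ‖l₃‖ ≠ 1)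
    {g : ℕ → ℝ} (hg : Tendsto g atTop (𝓝 0)) :
    ∃ w : ℕ → ℝ, Tendsto w atTop (𝓝 0) ∧
      ∀ t, w (t + 3) + a * w (t + 2) + b * w (t + 1) + c * w t = g t := by
  have hg' : Tendsto (fun t => (g t : ℂ)) atTop (𝓝 0) := by
    simpa [Function.comp_def] using (Complex.continuous_ofReal.tendsto 0).comp hg
  -- With `S` the shift, the cubic operator is `(S - l₁)(S - l₂)(S - l₃)`, inverted one factor at a
  -- time. As the coefficients are real, the real part still solves the equation.
  obtain ⟨g₁, hg₁, e₁⟩ := exists_tendsto_zero_recurrence h₁ hg'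
  obtain ⟨g₂, hg₂, e₂⟩ := exists_tendsto_zero_recurrence h₂ hg₁
  obtain ⟨w, hw, e₃⟩ := exists_tendsto_zero_recurrence h₃ hg₂
  refine ⟨fun t => (w t).re, by simpa [Function.comp_def] using (Complex.continuous_re.tendsto 0).comp hw,
    fun t => ?_⟩
  have key : w (t + 3) + a * w (t + 2) + b * w (t + 1) + c * w t = g t := by
    have x₁ := e₁ t
    have x₂ := e₂ t
    have x₃ := e₂ (t + 1)
    have x₄ := e₃ t
    have x₅ := e₃ (t + 1)
    have x₆ := e₃ (t + 2)
    simp only [add_assoc, one_add_one_eq_two, show (2 : ℕ) + 1 = 3 from rfl] at x₁ x₂ x₃ x₄ x₅ x₆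
    rw [ha, hb, hc]
    linear_combination x₆ - (l₁ + l₂) * x₅ + l₁ * l₂ * x₄ + x₃ - l₁ * x₂ + x₁
  simpa using congrArg Complex.re key

/-- The norms are nondecreasing in time, yet tend to zero. -/
theorem eq_zero_of_tendsto_zero_of_one_lt_norm {l : ℂ} (hl : 1 < ‖l‖) {y : ℕ → ℂ}
    (hy : Tendsto y atTop (𝓝 0)) (h : ∀ t, y (t + 1) = l * y t) (t : ℕ) : y t = 0 := by
  have hmono (n : ℕ) : ‖y t‖ ≤ ‖y (n + t)‖ := by
    induction n with
    | zero => simp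
    | succ n ih =>
      rw [show n + 1 + t = n + t + 1 by ring, h, norm_mul]
      nlinarith [norm_nonneg (y (n + t))]
  have hlim : Tendsto (fun n => ‖y (n + t)‖) atTop (𝓝 0) := by
    simpa using (hy.comp (tendsto_add_atTop_nat t)).norm
  exact norm_le_zero_iff.1 (ge_of_tendsto' hlim hmono)

/-- If `D` is annihilated by a cubic without roots on the unit circle, then `h ↦ (h (t+1) - D (h t))`
is surjective on sequences tending to zero. -/
theorem exists_tendsto_zero_orbit {ι : Type*} [Fintype ι] (D : (ι → ℝ) →ₗ[ℝ] (ι → ℝ)) {a b c : ℝ} {l₁ l₂ l₃ : ℂ}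
    (hD : ∀ v, D (D (D v)) + a • D (D v) + b • D v + c • v = 0)
    (ha : (a : ℂ) = -(l₁ + l₂ + l₃)) (hb : (b : ℂ) = l₁ * l₂ + l₁ * l₃ + l₂ * l₃)
    (hc : (c : ℂ) = -(l₁ * l₂ * l₃)) (h₁ : ‖l₁‖ ≠ 1) (h₂ : ‖l₂‖ ≠ 1) (h₃ : ‖l₃‖ ≠ 1)
    {g : ℕ → ι → ℝ} (hg : Tendsto g atTop (𝓝 0)) :
    ∃ h : ℕ → ι → ℝ, Tendsto h atTop (𝓝 0) ∧ ∀ t, h (t + 1) = D (h t) + g t := by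
  have hgm (m : ι) : Tendsto (fun t => g t m) atTop (𝓝 0) := (tendsto_pi_nhds.1 hg) m
  choose w hw e using fun m => exists_tendsto_zero_cubic_recurrence ha hb hc h₁ h₂ h₃ (hgm m)
  set W : ℕ → ι → ℝ := fun t m => w m t with hWdef
  have hW : Tendsto W atTop (𝓝 0) := tendsto_pi_nhds.2 hw
  have hWn (n : ℕ) : Tendsto (fun t => W (t + n)) atTop (𝓝 0) := hW.comp (tendsto_add_atTop_nat n)
  have hDt {x : ℕ → ι → ℝ} (hx : Tendsto x atTop (𝓝 0)) :
      Tendsto (fun t => D (x t)) atTop (𝓝 0) := by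
    simpa [Function.comp_def] using (D.continuous_of_finiteDimensional.tendsto 0).comp hx
  have eW (t : ℕ) : W (t + 3) + a • W (t + 2) + b • W (t + 1) + c • W t = g t := by
    ext m
    simpa using e m t
  -- With `S` the shift and `q` the cubic, `q(S) W = g`. As `q(D) = 0` and `S` commutes with `D`,
  -- `q(S) = q(S) - q(D)` equals `(S - D)(S² + S D + D² + a (S + D) + b)`, and the second factor
  -- applied to `W` is the witness.
  refine ⟨fun t => W (t + 2) + D (W (t + 1)) + D (D (W t)) + a • (W (t + 1) + D (W t)) + b • W t,
    ?_, fun t => ?_⟩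
  · simpa using ((((hWn 2).add (hDt (hWn 1))).add (hDt (hDt hW))).add
      (((hWn 1).add (hDt hW)).const_smul a)).add (hW.const_smul b)
  · simp only [map_add, map_smul]
    rw [← eW t, ← sub_eq_zero, ← hD (W t), show t + 1 + 2 = t + 3 by ring,
      show t + 1 + 1 = t + 2 by ring]
    simp only [smul_add]
    have := hD (W t)
    ext m
    have h := congrFun this m
    simp only [Pi.add_apply, Pi.smul_apply, Pi.sub_apply, Pi.zero_apply, smul_eq_mul] at h ⊢
    linarith

/-- Initial values of orbits of `D` tending to zero lie in the eigenspace of the only root inside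
the unit circle. -/
theorem map_eq_smul_of_tendsto_zero {ι : Type*} (D : (ι → ℝ) →ₗ[ℝ] (ι → ℝ)) {a b c l₁ : ℝ} {l₂ l₃ : ℂ}
    (hD : ∀ v, D (D (D v)) + a • D (D v) + b • D v + c • v = 0)
    (ha : (a : ℂ) = -(l₁ + l₂ + l₃)) (hb : (b : ℂ) = l₁ * l₂ + l₁ * l₃ + l₂ * l₃)
    (hc : (c : ℂ) = -(l₁ * l₂ * l₃)) (h₂ : 1 < ‖l₂‖) (h₃ : 1 < ‖l₃‖)
    {h : ℕ → ι → ℝ} (hh : Tendsto h atTop (𝓝 0)) (e : ∀ t, h (t + 1) = D (h t)) :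
    D (h 0) = l₁ • h 0 := by
  ext m
  have hm : Tendsto (fun t => (h t m : ℂ)) atTop (𝓝 0) := by
    simpa [Function.comp_def] using (Complex.continuous_ofReal.tendsto 0).comp ((tendsto_pi_nhds.1 hh) m)
  have hmn (n : ℕ) : Tendsto (fun t => (h (t + n) m : ℂ)) atTop (𝓝 0) :=
    hm.comp (tendsto_add_atTop_nat n)
  have e3 (t : ℕ) : (h (t + 3) m : ℂ) + a * h (t + 2) m + b * h (t + 1) m + c * h t m = 0 := by
    have := congrFun (hD (h t)) m
    rw [← e, ← e, ← e] at this
    exact_mod_cast this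
  -- Each coordinate is killed by `(S - l₂)(S - l₃)(S - l₁)`. The two expanding factors are
  -- injective on null sequences and are removed in turn.
  have hz : Tendsto (fun t => (h (t + 1) m : ℂ) - l₁ * h t m) atTop (𝓝 0) := by
    simpa using (hmn 1).sub (hm.const_mul (l₁ : ℂ))
  have hy := eq_zero_of_tendsto_zero_of_one_lt_norm h₂
    (y := fun t => ((h (t + 2) m : ℂ) - l₁ * h (t + 1) m) - l₃ * (h (t + 1) m - l₁ * h t m))
    (by simpa using (hz.comp (tendsto_add_atTop_nat 1)).sub (hz.const_mul l₃))
    (fun t => by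
      have := e3 t
      rw [ha, hb, hc] at this
      rw [show t + 1 + 2 = t + 3 by ring, show t + 1 + 1 = t + 2 by ring]
      linear_combination this)
  have := eq_zero_of_tendsto_zero_of_one_lt_norm h₃ hz (fun t => by
      have := hy t
      rw [show t + 1 + 1 = t + 2 by ring]
      linear_combination this) 0
  rw [zero_add, e 0, sub_eq_zero] at this
  exact_mod_cast this

/-! ### Roots of a cubic -/

/-- A real monic cubic `q` with `q(0) < -1`, `q(1) > 0` and no root in `(-∞, 0]` has one root in
`(0, 1)` and two outside the unit circle. -/
theorem exists_cubic_roots {a b c : ℝ} (h0 : c < -1) (h1 : 0 < 1 + a + b + c)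
    (hneg : ∀ x ≤ 0, x ^ 3 + a * x ^ 2 + b * x + c < 0) :
    ∃ (l₁ : ℝ) (l₂ l₃ : ℂ), 0 < l₁ ∧ l₁ < 1 ∧ 1 < ‖l₂‖ ∧ 1 < ‖l₃‖ ∧
      (a : ℂ) = -(l₁ + l₂ + l₃) ∧ (b : ℂ) = l₁ * l₂ + l₁ * l₃ + l₂ * l₃ ∧
      (c : ℂ) = -(l₁ * l₂ * l₃) ∧ (l₂.im = 0 → l₃.im = 0 ∧ 1 < l₂.re ∧ 1 < l₃.re) := by
  obtain ⟨r, ⟨hr0, hr1⟩, hr⟩ : (0 : ℝ) ∈ (fun x : ℝ => x ^ 3 + a * x ^ 2 + b * x + c) '' Ioo 0 1 :=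
    intermediate_value_Ioo zero_le_one (by fun_prop)
      ⟨by norm_num; linarith, by norm_num; linarith⟩
  simp only at hr
  -- Division by `x - r` leaves `x² + p x + s`, and `r s = -c > 1` with `r < 1` forces `s > 1`.
  set p := a + r with hp
  set s := b + r * p with hs
  have hcs : c = -(r * s) := by rw [hs, hp]; linear_combination hr
  have hs1 : 1 < s := by nlinarith
  obtain ⟨z, hz⟩ : ∃ z : ℂ, z ^ 2 + p * z + s = 0 := by
    obtain ⟨d, hd⟩ := IsAlgClosed.exists_pow_nat_eq ((p : ℂ) ^ 2 - 4 * s) (n := 2) (by norm_num)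
    exact ⟨(-p + d) / 2, by linear_combination hd / 4⟩
  have hsum : z + (-p - z) = -(p : ℂ) := by ring
  have hprod : z * (-p - z) = (s : ℂ) := by linear_combination -hz
  have hre := congrArg Complex.re hz
  have him := congrArg Complex.im hz
  simp only [pow_two, Complex.add_re, Complex.mul_re, Complex.ofReal_re, Complex.ofReal_im,
    Complex.zero_re, Complex.add_im, Complex.mul_im, Complex.zero_im] at hre him
  have hreal : z.im = 0 → 1 < z.re ∧ 1 < -p - z.re := by
    intro h
    simp only [h, mul_zero, sub_zero] at hre
    have hq {x : ℝ} (hx : x * x + p * x + s = 0) : 0 < x := by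
      by_contra! hx0
      have := hneg x hx0
      have h2 : x ^ 3 + a * x ^ 2 + b * x + c = (x - r) * (x * x + p * x + s) := by
        rw [hcs, hs, hp]; ring
      rw [h2, hx, mul_zero] at this
      exact lt_irrefl _ this
    have z0 := hq (x := z.re) (by linarith)
    have w0 := hq (x := -p - z.re) (by nlinarith)
    -- The quadratic is positive at `1`, so two real roots lie on the same side of `1`; being
    -- positive with product `s > 1`, they lie above it.
    have h11 : 0 < 1 + p + s := by
      have : 1 + a + b + c = (1 - r) * (1 + p + s) := by rw [hcs, hs, hp]; ring
      rw [this] at h1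
      exact pos_of_mul_pos_right h1 (by linarith)
    have hps : z.re * (-p - z.re) = s := by linarith
    have h12 : 0 < (1 - z.re) * (1 - (-p - z.re)) := by nlinarith
    constructor
    · by_contra! hle
      nlinarith
    · by_contra! hle
      nlinarith
  have hnorm : 1 < ‖z‖ ∧ 1 < ‖-(p : ℂ) - z‖ := by
    by_cases h : z.im = 0
    · obtain ⟨h2, h3⟩ := hreal h
      refine ⟨h2.trans_le (Complex.re_le_norm z), ?_⟩
      have := Complex.re_le_norm (-(p : ℂ) - z)
      simp only [Complex.sub_re, Complex.neg_re, Complex.ofReal_re] at this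
      exact h3.trans_le this
    -- Non-real roots are conjugate, so `‖z‖² = s > 1`.
    · have hp2 : p = -2 * z.re := by
        have : z.im * (2 * z.re + p) = 0 := by linarith
        rcases mul_eq_zero.1 this with h' | h'
        · exact absurd h' h
        · linarith
      have hconj : -(p : ℂ) - z = starRingEnd ℂ z := by
        apply Complex.ext <;> simp [hp2]
        ring
      have hn : 1 < ‖z‖ := by
        have : ‖z‖ * ‖z‖ = s := by
          rw [← pow_two, ← Complex.normSq_eq_norm_sq, Complex.normSq_apply]
          rw [hp2] at hre
          linarith
        nlinarith [norm_nonneg z]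
      exact ⟨hn, by rwa [hconj, Complex.norm_conj]⟩
  refine ⟨r, z, -p - z, hr0, hr1, hnorm.1, hnorm.2, ?_, ?_, ?_, fun h => ?_⟩
  · rw [hp]; push_cast; ring
  · have : (b : ℂ) = s - r * p := by rw [hs]; push_cast; ring
    rw [this, ← hprod]; ring
  · rw [hcs, mul_assoc, hprod]; push_cast; ring
  · refine ⟨by simp [h], by simpa using hreal h⟩

end Capital

noncomputable section

namespace Capital

open scoped ZeroAtInfty BoundedContinuousFunction

variable {E : Type*} [NormedAddCommGroup E]

/-! ### The space of sequences tending to zero -/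

namespace NullSeq

/-- Bundle a sequence tending to zero. -/
def mk (x : ℕ → E) (hx : Tendsto x atTop (𝓝 0)) : C₀(ℕ, E) :=
  ⟨⟨x, continuous_of_discreteTopology⟩, by
    rwa [Nat.cofinite_eq_atTop.symm, ← Filter.cocompact_eq_cofinite] at hx⟩

@[simp]
theorem mk_apply (x : ℕ → E) (hx : Tendsto x atTop (𝓝 0)) (t : ℕ) : mk x hx t = x t := rfl

theorem tendsto (x : C₀(ℕ, E)) : Tendsto x atTop (𝓝 0) := by
  have := x.zero_at_infty'
  rwa [Filter.cocompact_eq_cofinite, Nat.cofinite_eq_atTop] at this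

theorem norm_apply_le (x : C₀(ℕ, E)) (t : ℕ) : ‖x t‖ ≤ ‖x‖ :=
  x.toBCF.norm_coe_le_norm t

theorem norm_le {x : C₀(ℕ, E)} {C : ℝ} (hC : 0 ≤ C) (h : ∀ t, ‖x t‖ ≤ C) : ‖x‖ ≤ C :=
  (BoundedContinuousFunction.norm_le (f := x.toBCF) hC).2 h

variable {F : Type*} [NormedAddCommGroup F]

/-- The sequence `(A (xₜ))`, for `A` continuous at `0`. -/
def symbol (A : E → F) (hA : ContinuousAt A 0) (x : C₀(ℕ, E)) : ℕ →ᵇ F :=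
  BoundedContinuousFunction.ofNormedAddCommGroupDiscrete (fun t => A (x t))
    (hA.tendsto.comp (tendsto x)).norm.bddAbove_range.choose
    fun t => (hA.tendsto.comp (tendsto x)).norm.bddAbove_range.choose_spec ⟨t, rfl⟩

/-- Closed balls of `E` are compact, so `A` is uniformly continuous there and one modulus serves all
times `t`. -/
theorem continuousOn_symbol [ProperSpace E] {A : E → F} (hA : ContinuousAt A 0) {r : ℝ}
    (hAr : ContinuousOn A (Metric.closedBall 0 r)) :
    ContinuousOn (symbol A hA) (Metric.ball 0 r) := by
  have hu := (isCompact_closedBall (0 : E) r).uniformContinuousOn_of_continuous hAr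
  have hmem {x : C₀(ℕ, E)} (hx : x ∈ Metric.ball 0 r) (t : ℕ) :
      x t ∈ Metric.closedBall (0 : E) r := by
    rw [mem_ball_zero_iff] at hx
    rw [mem_closedBall_zero_iff]
    exact (norm_apply_le x t).trans hx.le
  refine UniformContinuousOn.continuousOn (Metric.uniformContinuousOn_iff_le.2 fun ε hε => ?_)
  obtain ⟨δ, hδ, h⟩ := Metric.uniformContinuousOn_iff_le.1 hu ε hε
  refine ⟨δ, hδ, fun x hx y hy hxy => (BoundedContinuousFunction.dist_le hε.le).2 fun t => ?_⟩
  refine h _ (hmem hx t) _ (hmem hy t) ?_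
  rw [dist_eq_norm] at hxy ⊢
  exact (norm_apply_le (x - y) t).trans hxy

/-- The superposition operator of a map fixing `0`. -/
def superpose (Φ : E → E) (hΦ : Tendsto Φ (𝓝 0) (𝓝 0)) (x : C₀(ℕ, E)) : C₀(ℕ, E) :=
  mk (fun t => Φ (x t)) (hΦ.comp (tendsto x))

variable [NormedSpace ℝ E]

/-- Evaluation at time `t`. -/
def eval (t : ℕ) : C₀(ℕ, E) →L[ℝ] E :=
  LinearMap.mkContinuous ⟨⟨fun x => x t, fun _ _ => rfl⟩, fun _ _ => rfl⟩ 1 fun x => by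
    simpa using norm_apply_le x t

/-- The left shift. -/
def shift : C₀(ℕ, E) →L[ℝ] C₀(ℕ, E) :=
  LinearMap.mkContinuous
    ⟨⟨fun x => mk (fun t => x (t + 1)) ((tendsto x).comp (tendsto_add_atTop_nat 1)),
      fun _ _ => rfl⟩, fun _ _ => rfl⟩ 1 fun x =>
    norm_le (by positivity) fun t => by
      rw [one_mul]
      exact norm_apply_le x (t + 1)

/-- A bounded sequence of operators acts on sequences tending to zero. -/
def mulOp : (ℕ →ᵇ (E →L[ℝ] E)) →L[ℝ] C₀(ℕ, E) →L[ℝ] C₀(ℕ, E) :=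
  LinearMap.mkContinuous₂
    (LinearMap.mk₂ ℝ
      (fun (a : ℕ →ᵇ (E →L[ℝ] E)) (x : C₀(ℕ, E)) => mk (fun t => a t (x t)) <| by
        refine squeeze_zero_norm (fun t => (a t).le_of_opNorm_le (a.norm_coe_le_norm t) (x t)) ?_
        simpa using (tendsto x).norm.const_mul ‖a‖)
      (fun _ _ _ => rfl) (fun _ _ _ => rfl)
      (fun a x y => by ext t : 1; exact map_add (a t) _ _)
      (fun r a x => by ext t : 1; exact map_smul (a t) _ _))
    1 fun a x => norm_le (by positivity) fun t => by
      rw [one_mul]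
      exact ((a t).le_of_opNorm_le (a.norm_coe_le_norm t) (x t)).trans
        (by gcongr; exact norm_apply_le x t)


/-- Uniform continuity of `Φ'` bounds the Taylor remainder of `Φ` at `x t` uniformly in `t`, which
is what the sup norm requires. -/
theorem hasFDerivAt_superpose [ProperSpace E] {Φ : E → E} (hΦ : Tendsto Φ (𝓝 0) (𝓝 0))
    {Φ' : E → E →L[ℝ] E} (hΦ'0 : ContinuousAt Φ' 0) {r : ℝ}
    (hΦ' : ContinuousOn Φ' (Metric.closedBall 0 r))
    (hd : ∀ x ∈ Metric.closedBall 0 r, HasFDerivAt Φ (Φ' x) x)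
    {x : C₀(ℕ, E)} (hx : x ∈ Metric.ball 0 r) :
    HasFDerivAt (superpose Φ hΦ) (mulOp (symbol Φ' hΦ'0 x)) x := by
  have hu := (isCompact_closedBall (0 : E) r).uniformContinuousOn_of_continuous hΦ'
  rw [hasFDerivAt_iff_isLittleO, Asymptotics.isLittleO_iff]
  intro ε hε
  obtain ⟨δ, hδ, h⟩ := Metric.uniformContinuousOn_iff_le.1 hu ε hε
  filter_upwards [Metric.ball_mem_nhds x hδ, Metric.isOpen_ball.mem_nhds hx] with y hy hyr
  have hmem {x : C₀(ℕ, E)} (hx : x ∈ Metric.ball 0 r) (t : ℕ) :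
      x t ∈ Metric.closedBall (0 : E) r := by
    rw [mem_ball_zero_iff] at hx
    rw [mem_closedBall_zero_iff]
    exact (norm_apply_le x t).trans hx.le
  refine norm_le (by positivity) fun t => ?_
  have hyx : y t ∈ Metric.closedBall (x t) δ := by
    rw [Metric.mem_ball, dist_eq_norm] at hy
    rw [Metric.mem_closedBall, dist_eq_norm]
    exact (norm_apply_le (y - x) t).trans hy.le
  -- On this convex intersection `Φ'` stays within `ε` of `Φ' (x t)`, so the mean value inequality
  -- has constant `ε`.
  have hmv := ((convex_closedBall (0 : E) r).inter
    (convex_closedBall (x t) δ)).norm_image_sub_le_of_norm_hasFDerivWithin_le'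
    (f := Φ) (f' := Φ') (φ := Φ' (x t)) (C := ε) (x := x t) (y := y t)
    (fun z hz => (hd z hz.1).hasFDerivWithinAt)
    (fun z hz => by
      rw [← dist_eq_norm]
      exact h _ hz.1 _ (hmem hx t) hz.2)
    ⟨hmem hx t, Metric.mem_closedBall_self hδ.le⟩ ⟨hmem hyr t, hyx⟩
  change ‖Φ (y t) - Φ (x t) - Φ' (x t) (y t - x t)‖ ≤ _
  exact hmv.trans (mul_le_mul_of_nonneg_left (norm_apply_le (y - x) t) hε.le)

theorem contDiffAt_superpose [ProperSpace E] {Φ : E → E} (hΦ : Tendsto Φ (𝓝 0) (𝓝 0))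
    {Φ' : E → E →L[ℝ] E} (hΦ'0 : ContinuousAt Φ' 0) {r : ℝ} (hr : 0 < r)
    (hΦ' : ContinuousOn Φ' (Metric.closedBall 0 r))
    (hd : ∀ x ∈ Metric.closedBall 0 r, HasFDerivAt Φ (Φ' x) x) :
    ContDiffAt ℝ 1 (superpose Φ hΦ) 0 :=
  contDiffAt_one_iff.2 ⟨fun x => mulOp (symbol Φ' hΦ'0 x), _, Metric.ball_mem_nhds 0 hr,
    mulOp.continuous.comp_continuousOn (continuousOn_symbol hΦ'0 hΦ'),
    fun _ hx => hasFDerivAt_superpose hΦ hΦ'0 hΦ' hd hx⟩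

/-- The `C¹` map whose zeros are the orbits of `Φ` that tend to `0` and start in `π = 0`. -/
def orbitMap (π : E →L[ℝ] ℝ) (Φ : E → E) (hΦ : Tendsto Φ (𝓝 0) (𝓝 0)) (x : C₀(ℕ, E)) :
    ℝ × C₀(ℕ, E) :=
  (π (x 0), shift x - superpose Φ hΦ x)

theorem orbitMap_snd_apply (π : E →L[ℝ] ℝ) (Φ : E → E) (hΦ : Tendsto Φ (𝓝 0) (𝓝 0))
    (x : C₀(ℕ, E)) (t : ℕ) : (orbitMap π Φ hΦ x).2 t = x (t + 1) - Φ (x t) := rfl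

/-- The derivative of `orbitMap`. -/
def orbitDeriv (π : E →L[ℝ] ℝ) (a : ℕ →ᵇ (E →L[ℝ] E)) : C₀(ℕ, E) →L[ℝ] ℝ × C₀(ℕ, E) :=
  (π.comp (eval 0)).prod (shift - mulOp a)

theorem orbitDeriv_fst (π : E →L[ℝ] ℝ) (a : ℕ →ᵇ (E →L[ℝ] E)) (x : C₀(ℕ, E)) :
    (orbitDeriv π a x).1 = π (x 0) := rfl

theorem orbitDeriv_snd_apply (π : E →L[ℝ] ℝ) (a : ℕ →ᵇ (E →L[ℝ] E)) (x : C₀(ℕ, E)) (t : ℕ) :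
    (orbitDeriv π a x).2 t = x (t + 1) - a t (x t) := rfl

theorem contDiffAt_orbitMap [ProperSpace E] (π : E →L[ℝ] ℝ) {Φ : E → E}
    (hΦ : Tendsto Φ (𝓝 0) (𝓝 0))
    {Φ' : E → E →L[ℝ] E} (hΦ'0 : ContinuousAt Φ' 0) {r : ℝ} (hr : 0 < r)
    (hΦ' : ContinuousOn Φ' (Metric.closedBall 0 r))
    (hd : ∀ x ∈ Metric.closedBall 0 r, HasFDerivAt Φ (Φ' x) x) :
    ContDiffAt ℝ 1 (orbitMap π Φ hΦ) 0 := by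
  have h1 : ContDiffAt ℝ 1 (π.comp (eval 0)) (0 : C₀(ℕ, E)) :=
    (ContinuousLinearMap.contDiff _).contDiffAt
  have h2 : ContDiffAt ℝ 1 shift (0 : C₀(ℕ, E)) := (ContinuousLinearMap.contDiff _).contDiffAt
  exact h1.prodMk (h2.sub (contDiffAt_superpose hΦ hΦ'0 hr hΦ' hd))

theorem hasFDerivAt_orbitMap [ProperSpace E] (π : E →L[ℝ] ℝ) {Φ : E → E}
    (hΦ : Tendsto Φ (𝓝 0) (𝓝 0))
    {Φ' : E → E →L[ℝ] E} (hΦ'0 : ContinuousAt Φ' 0) {r : ℝ} (hr : 0 < r)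
    (hΦ' : ContinuousOn Φ' (Metric.closedBall 0 r))
    (hd : ∀ x ∈ Metric.closedBall 0 r, HasFDerivAt Φ (Φ' x) x) :
    HasFDerivAt (orbitMap π Φ hΦ) (orbitDeriv π (symbol Φ' hΦ'0 0)) 0 :=
  (π.comp (eval 0)).hasFDerivAt.prodMk (shift.hasFDerivAt.sub
    (hasFDerivAt_superpose hΦ hΦ'0 hΦ' hd (Metric.mem_ball_self hr)))

theorem ker_orbitDeriv {π : E →L[ℝ] ℝ} {a : ℕ →ᵇ (E →L[ℝ] E)}
    (hinj : ∀ h : ℕ → E, Tendsto h atTop (𝓝 0) → (∀ t, h (t + 1) = a t (h t)) →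
      π (h 0) = 0 → h 0 = 0) : (orbitDeriv π a).ker = ⊥ := by
  refine LinearMap.ker_eq_bot'.2 fun x (hx : orbitDeriv π a x = 0) => ?_
  have h1 : π (x 0) = 0 := by
    rw [← orbitDeriv_fst π a x, hx]
    rfl
  have h2 (t : ℕ) : x (t + 1) = a t (x t) := by
    rw [← sub_eq_zero, ← orbitDeriv_snd_apply π, hx]
    rfl
  have h0 := hinj x (tendsto x) h2 h1
  ext t : 1
  induction t with
  | zero => exact h0
  | succ t ih => rw [h2, ih]; simp

theorem range_orbitDeriv {π : E →L[ℝ] ℝ} {a : ℕ →ᵇ (E →L[ℝ] E)}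
    (hsurj : ∀ (s : ℝ) (g : ℕ → E), Tendsto g atTop (𝓝 0) → ∃ h : ℕ → E,
      Tendsto h atTop (𝓝 0) ∧ π (h 0) = s ∧ ∀ t, h (t + 1) = a t (h t) + g t) :
    (orbitDeriv π a).range = ⊤ := by
  refine LinearMap.range_eq_top.2 fun y => ?_
  obtain ⟨h, hh, h1, h2⟩ := hsurj y.1 y.2 (tendsto y.2)
  refine ⟨mk h hh, ?_⟩
  change orbitDeriv π a (mk h hh) = y
  refine Prod.ext ?_ ?_
  · rw [orbitDeriv_fst, mk_apply, h1]
  · ext t : 1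
    rw [orbitDeriv_snd_apply, mk_apply, mk_apply, h2, add_sub_cancel_left]

end NullSeq

variable [NormedSpace ℝ E]

/-! ### The local stable manifold -/

/-- A `C¹` map with bijective derivative at a zero has a local `C¹` right inverse. -/
theorem exists_local_right_inverse {X Y : Type*} [NormedAddCommGroup X] [NormedSpace ℝ X]
    [CompleteSpace X] [NormedAddCommGroup Y] [NormedSpace ℝ Y] [CompleteSpace Y] {Ψ : X → Y}
    (hΨ : ContDiffAt ℝ 1 Ψ 0) (hΨ0 : Ψ 0 = 0) {L : X →L[ℝ] Y} (hL : HasFDerivAt Ψ L 0)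
    (hker : L.ker = ⊥) (hrange : L.range = ⊤) :
    ∃ G : Y → X, ContDiffAt ℝ 1 G 0 ∧ G 0 = 0 ∧ ∀ᶠ y in 𝓝 0, Ψ (G y) = y := by
  have hL' : HasFDerivAt Ψ (ContinuousLinearEquiv.ofBijective L hker hrange : X →L[ℝ] Y) 0 := by
    rwa [ContinuousLinearEquiv.coe_ofBijective]
  have h1 := hΨ.to_localInverse hL' one_ne_zero
  have h2 := hΨ.localInverse_apply_image hL' one_ne_zero
  have h3 := (hΨ.hasStrictFDerivAt' hL' one_ne_zero).eventually_right_inverse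
  rw [hΨ0] at h1 h2 h3
  exact ⟨_, h1, h2, h3⟩

open NullSeq in
/-- The local stable manifold at the fixed point `0`, as a curve parametrized by the functional `π`,
by Irwin's method: the stable orbits are the zeros of a `C¹` map between sequence spaces. -/
theorem exists_stable_curve_zero [ProperSpace E] {Φ : E → E}
    (hΦ : ContDiffAt ℝ 1 Φ 0) (hΦ0 : Φ 0 = 0) (π : E →L[ℝ] ℝ)
    (hsurj : ∀ (s : ℝ) (g : ℕ → E), Tendsto g atTop (𝓝 0) → ∃ h : ℕ → E,
      Tendsto h atTop (𝓝 0) ∧ π (h 0) = s ∧ ∀ t, h (t + 1) = fderiv ℝ Φ 0 (h t) + g t)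
    (hinj : ∀ h : ℕ → E, Tendsto h atTop (𝓝 0) → (∀ t, h (t + 1) = fderiv ℝ Φ 0 (h t)) →
      π (h 0) = 0 → h 0 = 0) :
    ∃ γ : ℝ → E, ContDiffAt ℝ 1 γ 0 ∧ γ 0 = 0 ∧ (∀ᶠ s in 𝓝 0, π (γ s) = s) ∧
      (∀ᶠ s in 𝓝 0, Tendsto (fun t => Φ^[t] (γ s)) atTop (𝓝 0)) ∧
      ∀ U ∈ 𝓝 (0 : E), ∀ᶠ s in 𝓝 0, ∀ t, Φ^[t] (γ s) ∈ U := by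
  have hΦt : Tendsto Φ (𝓝 0) (𝓝 0) := by
    simpa [ContinuousAt, hΦ0] using hΦ.continuousAt
  obtain ⟨Φ', u, hu, hc, hd⟩ := contDiffAt_one_iff.1 hΦ
  obtain ⟨r, hr, hru⟩ := Metric.nhds_basis_closedBall.mem_iff.1 hu
  have hΦ'0 : ContinuousAt Φ' 0 := hc.continuousAt hu
  have hD : fderiv ℝ Φ 0 = Φ' 0 := (hd 0 (mem_of_mem_nhds hu)).fderiv
  rw [hD] at hsurj hinj
  have hc' := hc.mono hru
  have hd' : ∀ x ∈ Metric.closedBall 0 r, HasFDerivAt Φ (Φ' x) x := fun x hx => hd x (hru hx)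
  have hΨ0 : orbitMap π Φ hΦt 0 = 0 := by
    refine Prod.ext (map_zero π) ?_
    ext t : 1
    rw [orbitMap_snd_apply]
    simp [hΦ0]
  -- The sequence `G (s, 0)` is a null orbit of `Φ` with `π`-coordinate `s` at time `0`; its initial
  -- point traces the stable curve.
  obtain ⟨G, hGc, hG0, hright⟩ := exists_local_right_inverse
    (contDiffAt_orbitMap π hΦt hΦ'0 hr hc' hd') hΨ0 (hasFDerivAt_orbitMap π hΦt hΦ'0 hr hc' hd')
    (ker_orbitDeriv hinj) (range_orbitDeriv hsurj)
  have hincl : ContDiffAt ℝ 1 (fun s : ℝ => ((s, 0) : ℝ × C₀(ℕ, E))) 0 := by fun_prop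
  have htend : Tendsto (fun s : ℝ => ((s, 0) : ℝ × C₀(ℕ, E))) (𝓝 0) (𝓝 0) := hincl.continuousAt
  have hGs : ContDiffAt ℝ 1 (fun s : ℝ => G (s, 0)) 0 := ContDiffAt.comp (g := G) 0 hGc hincl
  have horb : ∀ᶠ s in 𝓝 (0 : ℝ), ∀ t, Φ^[t] (G (s, 0) 0) = G (s, 0) t := by
    filter_upwards [htend.eventually hright] with s hs t
    induction t with
    | zero => rfl
    | succ t ih =>
      rw [Function.iterate_succ_apply', ih]
      rw [eq_comm, ← sub_eq_zero, ← orbitMap_snd_apply π Φ hΦt, hs]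
      rfl
  have hev : ContDiffAt ℝ 1 (fun x : C₀(ℕ, E) => x 0) (G ((0 : ℝ), 0)) :=
    (eval (E := E) 0).contDiff.contDiffAt
  refine ⟨fun s => G (s, 0) 0, ContDiffAt.comp (g := fun x : C₀(ℕ, E) => x 0) 0 hev hGs,
    ?_, ?_, ?_, fun U hU => ?_⟩
  · change G 0 0 = 0
    rw [hG0]
    rfl
  · filter_upwards [htend.eventually hright] with s hs
    exact congrArg Prod.fst hs
  · filter_upwards [horb] with s hs
    simpa only [hs] using tendsto (G (s, 0))
  -- The sup norm of `G (s, 0)` controls the orbit at all times at once.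
  · obtain ⟨ε, hε, hεU⟩ := Metric.mem_nhds_iff.1 hU
    have h1 : Tendsto (fun s : ℝ => ‖G (s, 0)‖) (𝓝 0) (𝓝 0) := by
      have := hGs.continuousAt.norm
      have h2 : ‖G ((0 : ℝ), 0)‖ = 0 := by
        change ‖G 0‖ = 0
        rw [hG0, norm_zero]
      rwa [ContinuousAt, h2] at this
    filter_upwards [horb, h1.eventually_lt_const hε] with s hs hlt t
    rw [hs]
    exact hεU (mem_ball_zero_iff.2 ((norm_apply_le _ t).trans_lt hlt))

/-- The local stable manifold at a fixed point `p`, as a curve parametrized by the functional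
`π`. -/
theorem exists_stable_curve [ProperSpace E] {Φ : E → E} {p : E}
    (hΦ : ContDiffAt ℝ 1 Φ p) (hp : Φ p = p) (π : E →L[ℝ] ℝ)
    (hsurj : ∀ (s : ℝ) (g : ℕ → E), Tendsto g atTop (𝓝 0) → ∃ h : ℕ → E,
      Tendsto h atTop (𝓝 0) ∧ π (h 0) = s ∧ ∀ t, h (t + 1) = fderiv ℝ Φ p (h t) + g t)
    (hinj : ∀ h : ℕ → E, Tendsto h atTop (𝓝 0) → (∀ t, h (t + 1) = fderiv ℝ Φ p (h t)) →
      π (h 0) = 0 → h 0 = 0) :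
    ∃ γ : ℝ → E, ContDiffAt ℝ 1 γ (π p) ∧ γ (π p) = p ∧ (∀ᶠ s in 𝓝 (π p), π (γ s) = s) ∧
      (∀ᶠ s in 𝓝 (π p), Tendsto (fun t => Φ^[t] (γ s)) atTop (𝓝 p)) ∧
      ∀ U ∈ 𝓝 p, ∀ᶠ s in 𝓝 (π p), ∀ t, Φ^[t] (γ s) ∈ U := by
  set Φ₀ : E → E := fun z => Φ (z + p) - p with hΦ₀
  have hd : fderiv ℝ Φ₀ 0 = fderiv ℝ Φ p := by
    rw [hΦ₀, fderiv_sub_const, fderiv_comp_add_right, zero_add]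
  have hc : ContDiffAt ℝ 1 Φ₀ 0 := by
    refine ContDiffAt.sub (ContDiffAt.comp (g := Φ) 0 (by rwa [zero_add]) ?_) contDiffAt_const
    fun_prop
  rw [← hd] at hsurj hinj
  obtain ⟨γ, h1, h2, h3, h4, h5⟩ := exists_stable_curve_zero hc (by simp [hΦ₀, hp]) π hsurj hinj
  have hiter (t : ℕ) (z : E) : Φ^[t] (z + p) = Φ₀^[t] z + p := by
    induction t with
    | zero => rfl
    | succ t ih => rw [Function.iterate_succ_apply', Function.iterate_succ_apply', ih, hΦ₀]; simp
  have htr : Tendsto (fun s => s - π p) (𝓝 (π p)) (𝓝 0) := by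
    simpa using ((continuous_sub_right (π p)).tendsto (π p))
  refine ⟨fun s => γ (s - π p) + p, ?_, by simp [h2], ?_, ?_, fun U hU => ?_⟩
  · refine ContDiffAt.add (ContDiffAt.comp (g := γ) _ (by rwa [sub_self]) ?_) contDiffAt_const
    fun_prop
  · filter_upwards [htr.eventually h3] with s hs
    rw [map_add, hs, sub_add_cancel]
  · filter_upwards [htr.eventually h4] with s hs
    simpa [hiter] using hs.add_const p
  · have hU' : (fun z => z + p) ⁻¹' U ∈ 𝓝 (0 : E) :=
      (continuous_add_const p).continuousAt.preimage_mem_nhds (by simpa using hU)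
    filter_upwards [htr.eventually (h5 _ hU')] with s hs t
    rw [hiter]
    exact hs t

end Capital

end

/-! ### Spectrum of the linearized equilibrium map -/

namespace Capital

open Polynomial

/-- The relations between the states `h` and `D h` in the linearized equilibrium conditions. -/
structure LinearizedStep (D : State →ₗ[ℝ] State) (ωi ωj δi δj ηi ηj R : ℝ) : Prop where
  eqI : ∀ h, ωi * D h 0 + δi * D h 1 = ωi * h 0 + ηi * D h 2
  eqJ : ∀ h, δj * D h 0 + ωj * D h 1 = ωj * h 1 + ηj * D h 2
  eqK : ∀ h, D h 2 = R * h 2 - h 0 - h 1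

namespace LinearizedStep

variable {D : State →ₗ[ℝ] State} {ωi ωj δi δj ηi ηj R : ℝ}

/-- The linearized conditions read `A J = B`, so `det A * det (x - J) = det (x A - B)`. -/
theorem charpoly_eval (hD : LinearizedStep D ωi ωj δi δj ηi ηj R) (x : ℝ) :
    (ωi * ωj - δi * δj) * (LinearMap.toMatrix' D).charpoly.eval x =
      (x - R) * ((x - 1) ^ 2 * (ωi * ωj) - x ^ 2 * (δi * δj)) - x ^ 2 * (δi * ηj + δj * ηi)
        + x * (x - 1) * (ηi * ωj + ηj * ωi) := by
  set J := LinearMap.toMatrix' D with hJ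
  set A : Matrix (Fin 3) (Fin 3) ℝ := !![ωi, δi, -ηi; δj, ωj, -ηj; 0, 0, 1] with hA
  set B : Matrix (Fin 3) (Fin 3) ℝ := !![ωi, 0, 0; 0, ωj, 0; -1, -1, R] with hB
  have hAJ : A * J = B := by
    have hJe (m n : Fin 3) : J m n = D (Pi.single n 1) m := by
      rw [hJ, LinearMap.toMatrix'_apply]
    ext m n
    have e1 := hD.eqI (Pi.single n 1)
    have e2 := hD.eqJ (Pi.single n 1)
    have e3 := hD.eqK (Pi.single n 1)
    rw [Matrix.mul_apply, Fin.sum_univ_three, hJe, hJe, hJe]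
    fin_cases n <;> fin_cases m <;> simp [hA, hB] at e1 e2 e3 ⊢ <;> linarith
  have hdetA : A.det = ωi * ωj - δi * δj := by
    rw [hA, Matrix.det_fin_three]
    simp
  have hprod : A * (Matrix.scalar (Fin 3) x - J) = x • A - B := by
    rw [mul_sub, hAJ, Matrix.scalar_apply, ← Matrix.smul_one_eq_diagonal, mul_smul_comm, mul_one]
  rw [Matrix.eval_charpoly, ← hdetA, ← Matrix.det_mul, hprod, Matrix.det_fin_three]
  simp [hA, hB]
  ring

/-- The characteristic polynomial of the linearized equilibrium map has one root in `(0, 1)` and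
two outside the unit circle. -/
theorem exists_roots (hD : LinearizedStep D ωi ωj δi δj ηi ηj R) (hδi : 0 < δi) (hδj : 0 < δj)
    (hωi : δi < ωi) (hωj : δj < ωj) (hηi : ηi < 0) (hηj : ηj < 0) (hR : 1 < R) :
    ∃ (a b c l₁ : ℝ) (l₂ l₃ : ℂ),
      (LinearMap.toMatrix' D).charpoly = X ^ 3 + C a * X ^ 2 + C b * X + C c ∧
      0 < l₁ ∧ l₁ < 1 ∧ 1 < ‖l₂‖ ∧ 1 < ‖l₃‖ ∧
      (a : ℂ) = -(l₁ + l₂ + l₃) ∧ (b : ℂ) = l₁ * l₂ + l₁ * l₃ + l₂ * l₃ ∧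
      (c : ℂ) = -(l₁ * l₂ * l₃) ∧ (l₂.im = 0 → l₃.im = 0 ∧ 1 < l₂.re ∧ 1 < l₃.re) := by
  have hωi0 := hδi.trans hωi
  have hωj0 := hδj.trans hωj
  have hdd : 0 < δi * δj := mul_pos hδi hδj
  have hΔ : 0 < ωi * ωj - δi * δj := by nlinarith
  set Δ := ωi * ωj - δi * δj with hΔdef
  set a := (-2 * (ωi * ωj) - R * Δ - (δi * ηj + δj * ηi) + (ηi * ωj + ηj * ωi)) / Δ with ha
  set b := (ωi * ωj + 2 * R * (ωi * ωj) - (ηi * ωj + ηj * ωi)) / Δ with hb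
  set c := -(R * (ωi * ωj)) / Δ with hc
  have hP (x : ℝ) : Δ * (x ^ 3 + a * x ^ 2 + b * x + c) =
      (x - R) * ((x - 1) ^ 2 * (ωi * ωj) - x ^ 2 * (δi * δj)) - x ^ 2 * (δi * ηj + δj * ηi)
        + x * (x - 1) * (ηi * ωj + ηj * ωi) := by
    have ha' : Δ * a = -2 * (ωi * ωj) - R * Δ - (δi * ηj + δj * ηi) + (ηi * ωj + ηj * ωi) := by
      rw [ha]; field_simp
    have hb' : Δ * b = ωi * ωj + 2 * R * (ωi * ωj) - (ηi * ωj + ηj * ωi) := by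
      rw [hb]; field_simp
    have hc' : Δ * c = -(R * (ωi * ωj)) := by
      rw [hc]; field_simp
    linear_combination x ^ 2 * ha' + x * hb' + hc' + x ^ 2 * (x - R) * hΔdef
  have hchar : (LinearMap.toMatrix' D).charpoly = X ^ 3 + C a * X ^ 2 + C b * X + C c := by
    refine Polynomial.funext fun x => mul_left_cancel₀ hΔ.ne' ?_
    have h := hD.charpoly_eval x
    rw [← hΔdef, ← hP] at h
    rw [h]
    simp
  -- Here `-c = R ωi ωj / Δ`, with `R > 1` and `0 < Δ < ωi ωj`.
  have h0 : c < -1 := by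
    rw [hc, div_lt_iff₀ hΔ]
    nlinarith [mul_pos hωi0 hωj0]
  have h1 : 0 < 1 + a + b + c := by
    have h := hP 1
    have h2 : Δ * (1 + a + b + c) = (R - 1) * (δi * δj) - (δi * ηj + δj * ηi) := by
      linear_combination h
    have h3 : 0 < Δ * (1 + a + b + c) := by
      rw [h2]
      have := mul_neg_of_pos_of_neg hδi hηj
      have := mul_neg_of_pos_of_neg hδj hηi
      have := mul_pos (sub_pos.2 hR) hdd
      linarith
    exact pos_of_mul_pos_right h3 hΔ.le
  have hneg : ∀ x ≤ 0, x ^ 3 + a * x ^ 2 + b * x + c < 0 := by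
    intro x hx
    have h2 : (x - R) * ((x - 1) ^ 2 * (ωi * ωj) - x ^ 2 * (δi * δj)) < 0 := by
      refine mul_neg_of_neg_of_pos (by linarith) ?_
      have e : (x - 1) ^ 2 * (ωi * ωj) - x ^ 2 * (δi * δj) =
          x ^ 2 * Δ + (-2 * x) * (ωi * ωj) + ωi * ωj := by rw [hΔdef]; ring
      rw [e]
      have := mul_pos hωi0 hωj0
      have := mul_nonneg (by linarith : 0 ≤ -2 * x) this.le
      have := mul_nonneg (sq_nonneg x) hΔ.le
      linarith
    -- The remaining terms of `hP`, grouped by `ηi` and by `ηj`, each have this form: one agent's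
    -- `η` with the `ω` and `δ` of the other.
    have h3 {η ω δ : ℝ} (hη : η < 0) (hδ : 0 < δ) (hω : δ < ω) :
        η * (x ^ 2 * (ω - δ) + (-x) * ω) ≤ 0 := by
      refine mul_nonpos_of_nonpos_of_nonneg hη.le (add_nonneg ?_ ?_)
      · exact mul_nonneg (sq_nonneg x) (by linarith)
      · exact mul_nonneg (by linarith) (hδ.trans hω).le
    have h4 := h3 hηi hδj hωj
    have h5 := h3 hηj hδi hωi
    have h6 := hP x
    by_contra! h7
    have h8 := mul_nonneg hΔ.le h7
    linarith
  obtain ⟨l₁, l₂, l₃, h⟩ := exists_cubic_roots h0 h1 hneg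
  exact ⟨a, b, c, l₁, l₂, l₃, hchar, h⟩

/-- An eigenvector for an eigenvalue in `(0, 1)` has a nonzero capital component. -/
theorem eq_zero_of_eigenvector (hD : LinearizedStep D ωi ωj δi δj ηi ηj R) (hδi : 0 < δi)
    (hωi : δi < ωi) {l : ℝ} (hl0 : 0 < l) (hl1 : l < 1) {v : State} (hv : D v = l • v)
    (hv2 : v 2 = 0) : v = 0 := by
  have e1 := hD.eqI v
  have e3 := hD.eqK v
  rw [hv] at e1 e3
  simp only [Pi.smul_apply, smul_eq_mul, hv2, mul_zero, add_zero, zero_sub] at e1 e3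
  -- Without capital, the two consumption components cancel in the capital equation. Agent `i`'s
  -- equation then multiplies `v 0` by a positive number.
  have h1 : v 1 = -v 0 := by linarith
  rw [h1] at e1
  have h0 : v 0 = 0 := by
    have h2 : (ωi * (1 - l) + δi * l) * v 0 = 0 := by linear_combination -e1
    have h3 : 0 < ωi * (1 - l) + δi * l :=
      add_pos (mul_pos (hδi.trans hωi) (by linarith)) (mul_pos hδi hl0)
    exact (mul_eq_zero.1 h2).resolve_left h3.ne'
  ext m
  fin_cases m
  · exact h0
  · simpa [h0] using h1
  · exact hv2

end LinearizedStep

section Charpoly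

variable {a b c l₁ : ℝ} {l₂ l₃ : ℂ} {J : Matrix (Fin 3) (Fin 3) ℝ}

theorem roots_charpoly_map (hJ : J.charpoly = X ^ 3 + C a * X ^ 2 + C b * X + C c)
    (ha : (a : ℂ) = -(l₁ + l₂ + l₃)) (hb : (b : ℂ) = l₁ * l₂ + l₁ * l₃ + l₂ * l₃)
    (hc : (c : ℂ) = -(l₁ * l₂ * l₃)) :
    (J.map (algebraMap ℝ ℂ)).charpoly.roots = {(l₁ : ℂ), l₂, l₃} := by
  have h : (J.map (algebraMap ℝ ℂ)).charpoly =
      (({(l₁ : ℂ), l₂, l₃} : Multiset ℂ).map fun z => X - C z).prod := by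
    rw [Matrix.charpoly_map, hJ]
    simp only [Polynomial.map_add, Polynomial.map_mul, Polynomial.map_pow, map_X, map_C,
      Complex.coe_algebraMap, ha, hb, hc, Multiset.insert_eq_cons, Multiset.map_cons,
      Multiset.prod_cons, Multiset.map_singleton, Multiset.prod_singleton, map_add, map_neg,
      map_mul]
    ring
  rw [h, Polynomial.roots_multiset_prod_X_sub_C]

/-- Real eigenvalues can be ordered. -/
theorem exists_ordered_roots
    (hroots : (J.map (algebraMap ℝ ℂ)).charpoly.roots = {(l₁ : ℂ), l₂, l₃})
    (h0 : 0 < l₁) (h1 : l₁ < 1)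
    (hreal : l₂.im = 0 → l₃.im = 0 ∧ 1 < l₂.re ∧ 1 < l₃.re) (hs : J.charpoly.Splits) :
    ∃ m₁ m₂ m₃ : ℝ, 0 < m₁ ∧ m₁ < 1 ∧ 1 < m₂ ∧ m₂ ≤ m₃ ∧ J.charpoly.roots = {m₁, m₂, m₃} ∧
      (J.charpoly.Separable → m₂ < m₃) := by
  have hmap : J.charpoly.roots.map (algebraMap ℝ ℂ) = {(l₁ : ℂ), l₂, l₃} := by
    rw [← hroots, Matrix.charpoly_map, hs.roots_map]
  have hl2 : l₂.im = 0 := by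
    have : l₂ ∈ J.charpoly.roots.map (algebraMap ℝ ℂ) := by
      rw [hmap]
      simp
    obtain ⟨r, -, hr⟩ := Multiset.mem_map.1 this
    rw [← hr]
    simp
  obtain ⟨hl3, h2, h3⟩ := hreal hl2
  have e2 : l₂ = (l₂.re : ℂ) := Complex.ext rfl (by simpa using hl2)
  have e3 : l₃ = (l₃.re : ℂ) := Complex.ext rfl (by simpa using hl3)
  have hroot : J.charpoly.roots = {l₁, l₂.re, l₃.re} := by
    apply Multiset.map_injective (algebraMap ℝ ℂ).injective
    rw [hmap, e2, e3]
    simp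
  have hsep : J.charpoly.Separable → l₂.re ≠ l₃.re := by
    intro h
    have := nodup_roots h
    rw [hroot] at this
    simp at this
    exact this.2
  rcases le_total l₂.re l₃.re with h | h
  · exact ⟨l₁, l₂.re, l₃.re, h0, h1, h2, h, hroot, fun hp => h.lt_of_ne (hsep hp)⟩
  · refine ⟨l₁, l₃.re, l₂.re, h0, h1, h3, h, ?_, fun hp => h.lt_of_ne (hsep hp).symm⟩
    rw [hroot, Multiset.insert_eq_cons, Multiset.insert_eq_cons, Multiset.pair_comm]
    rfl

end Charpoly

/-- Cayley–Hamilton, applied to a vector. -/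
theorem cubic_apply_eq_zero {a b c : ℝ} {D : State →ₗ[ℝ] State}
    (hJ : (LinearMap.toMatrix' D).charpoly = X ^ 3 + C a * X ^ 2 + C b * X + C c) (v : State) :
    D (D (D v)) + a • D (D v) + b • D v + c • v = 0 := by
  have h := LinearMap.aeval_self_charpoly D
  rw [← LinearMap.charpoly_toMatrix D (Pi.basisFun ℝ (Fin 3)), LinearMap.toMatrix_eq_toMatrix',
    hJ] at h
  have := LinearMap.congr_fun h v
  simpa [pow_succ, Algebra.algebraMap_eq_smul_one] using this

theorem exists_eigenvector_of_isRoot {D : State →ₗ[ℝ] State} {l : ℝ}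
    (h : (LinearMap.toMatrix' D).charpoly.IsRoot l) : ∃ v, v ≠ 0 ∧ D v = l • v := by
  rw [← LinearMap.toMatrix_eq_toMatrix', LinearMap.charpoly_toMatrix,
    ← Module.End.hasEigenvalue_iff_isRoot_charpoly] at h
  obtain ⟨v, hv⟩ := h.exists_hasEigenvector
  exact ⟨v, hv.2, hv.apply_eq_smul⟩

end Capital

/-! ### Smoothness and derivatives of the Euler equations -/

noncomputable section

namespace Capital

namespace Preferences

variable (P : Preferences)

theorem contDiffAt_deriv_u {c : ℝ} (hc : 0 < c) : ContDiffAt ℝ 1 (deriv P.u) c :=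
  ((P.u_smooth.deriv_of_isOpen (m := 1) isOpen_Ioi (by norm_num)).contDiffAt (Ioi_mem_nhds hc))

theorem contDiffAt_deriv_α {c : ℝ} (hc : 0 < c) : ContDiffAt ℝ 1 (deriv P.α) c :=
  ((P.α_smooth.deriv_of_isOpen (m := 1) isOpen_Ioi (by norm_num)).contDiffAt (Ioi_mem_nhds hc))

end Preferences

namespace Economy

variable (E : Economy)

theorem contDiffAt_deriv_f {k : ℝ} (hk : 0 < k) : ContDiffAt ℝ 1 (deriv E.f) k :=
  ((E.f_smooth.deriv_of_isOpen (m := 1) isOpen_Ioi (by norm_num)).contDiffAt (Ioi_mem_nhds hk))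

theorem contDiffAt_Fk {x : State} (hx : 0 < x 2) : ContDiffAt ℝ 1 E.Fk x := by
  have h1 : ContDiffAt ℝ 1 E.f (x 2) :=
    (E.f_smooth.contDiffAt (Ioi_mem_nhds hx)).of_le (by norm_num)
  have h2 : ContDiffAt ℝ 1 (fun x : State => E.f (x 2)) x :=
    ContDiffAt.comp (g := E.f) x h1 (contDiff_apply ℝ ℝ 2).contDiffAt
  exact (h2.sub (contDiff_apply ℝ ℝ 0).contDiffAt).sub (contDiff_apply ℝ ℝ 1).contDiffAt

/-- The derivative of next period's capital stock. -/
def dFk (R : ℝ) : State →L[ℝ] ℝ :=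
  R • ContinuousLinearMap.proj 2 - ContinuousLinearMap.proj 0 - ContinuousLinearMap.proj 1

@[simp]
theorem dFk_apply (R : ℝ) (h : State) : dFk R h = R * h 2 - h 0 - h 1 := rfl

theorem hasFDerivAt_Fk {x : State} (hx : 0 < x 2) : HasFDerivAt E.Fk (dFk (deriv E.f (x 2))) x := by
  have h1 : HasFDerivAt (fun x : State => E.f (x 2))
      (deriv E.f (x 2) • ContinuousLinearMap.proj (R := ℝ) (φ := fun _ : Fin 3 => ℝ) 2) x :=
    HasDerivAt.comp_hasFDerivAt (h₂ := E.f) x (E.hasDerivAt_f hx) (hasFDerivAt_apply 2 x)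
  exact (h1.sub (hasFDerivAt_apply 0 x)).sub (hasFDerivAt_apply 1 x)

/-- Marginal utility of the consumption `x m` of an agent with preferences `P` and value
function `v`. -/
def marginal (P : Preferences) (v : ℝ → ℝ) (m : Fin 3) (x : State) : ℝ :=
  deriv P.u (x m) + deriv P.α (x m) * v (E.Fk x)

theorem contDiffAt_marginal {P : Preferences} {v : ℝ → ℝ} {m : Fin 3} {x : State}
    (hx : 0 < x 2) (hm : 0 < x m) (hv : ContDiffAt ℝ 1 v (E.Fk x)) :
    ContDiffAt ℝ 1 (E.marginal P v m) x := by
  have hp : ContDiffAt ℝ 1 (fun x : State => x m) x := (contDiff_apply ℝ ℝ m).contDiffAt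
  have h1 : ContDiffAt ℝ 1 (fun x : State => deriv P.u (x m)) x :=
    ContDiffAt.comp (g := deriv P.u) x (P.contDiffAt_deriv_u hm) hp
  have h2 : ContDiffAt ℝ 1 (fun x : State => deriv P.α (x m)) x :=
    ContDiffAt.comp (g := deriv P.α) x (P.contDiffAt_deriv_α hm) hp
  have h3 : ContDiffAt ℝ 1 (fun x : State => v (E.Fk x)) x :=
    ContDiffAt.comp (g := v) x hv (E.contDiffAt_Fk hx)
  exact h1.add (h2.mul h3)

theorem hasFDerivAt_marginal {P : Preferences} {v : ℝ → ℝ} {m : Fin 3} {x : State}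
    (hx : 0 < x 2) (hm : 0 < x m) (hv : DifferentiableAt ℝ v (E.Fk x)) :
    HasFDerivAt (E.marginal P v m)
      ((deriv (deriv P.u) (x m) + deriv (deriv P.α) (x m) * v (E.Fk x)) •
          ContinuousLinearMap.proj (R := ℝ) (φ := fun _ : Fin 3 => ℝ) m +
        (deriv P.α (x m) * deriv v (E.Fk x)) • dFk (deriv E.f (x 2))) x := by
  have hp : HasFDerivAt (fun x : State => x m)
    (ContinuousLinearMap.proj (R := ℝ) (φ := fun _ : Fin 3 => ℝ) m) x := hasFDerivAt_apply m x
  have h1 := HasDerivAt.comp_hasFDerivAt (h₂ := deriv P.u) x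
    ((P.contDiffAt_deriv_u hm).differentiableAt one_ne_zero).hasDerivAt hp
  have h2 := HasDerivAt.comp_hasFDerivAt (h₂ := deriv P.α) x
    ((P.contDiffAt_deriv_α hm).differentiableAt one_ne_zero).hasDerivAt hp
  have h3 := HasDerivAt.comp_hasFDerivAt (h₂ := v) x hv.hasDerivAt (E.hasFDerivAt_Fk hx)
  refine (h1.add (h2.mul h3)).congr_fderiv ?_
  ext h
  simp
  ring

/-- The residual of the Euler equation of an agent. -/
def eulerResidual (P : Preferences) (v : ℝ → ℝ) (m : Fin 3) (z : State × State) : ℝ :=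
  E.marginal P v m z.1 - P.α (z.1 m) * E.marginal P v m z.2 * deriv E.f (z.2 2)

theorem contDiffAt_eulerResidual {P : Preferences} {v : ℝ → ℝ} {m : Fin 3} {x : State}
    (hx : 0 < x 2) (hm : 0 < x m) (hv : ContDiffAt ℝ 1 v (E.Fk x)) :
    ContDiffAt ℝ 1 (E.eulerResidual P v m) (x, x) := by
  have hU := E.contDiffAt_marginal (P := P) hx hm hv
  have h1 : ContDiffAt ℝ 1 (fun z : State × State => E.marginal P v m z.1) (x, x) :=
    ContDiffAt.comp (g := E.marginal P v m) (x, x) hU contDiffAt_fst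
  have h2 : ContDiffAt ℝ 1 (fun z : State × State => E.marginal P v m z.2) (x, x) :=
    ContDiffAt.comp (g := E.marginal P v m) (x, x) hU contDiffAt_snd
  have hα : ContDiffAt ℝ 1 P.α (x m) :=
    (P.α_smooth.contDiffAt (Ioi_mem_nhds hm)).of_le (by norm_num)
  have h3 : ContDiffAt ℝ 1 (fun z : State × State => P.α (z.1 m)) (x, x) :=
    ContDiffAt.comp (g := P.α) (x, x) hα (by fun_prop)
  have h4 : ContDiffAt ℝ 1 (fun z : State × State => deriv E.f (z.2 2)) (x, x) :=
    ContDiffAt.comp (g := deriv E.f) (x, x) (E.contDiffAt_deriv_f hx) (by fun_prop)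
  exact h1.sub ((h3.mul h2).mul h4)

/-- The derivative of the Euler residual at a stationary state satisfying the first order
conditions `α f' = 1` and `v' = U f'`. -/
theorem fderiv_eulerResidual {P : Preferences} {v : ℝ → ℝ} {m : Fin 3} {x : State} {R U δ ω η : ℝ}
    (hx : 0 < x 2) (hm : 0 < x m) (hv : ContDiffAt ℝ 1 v (E.Fk x)) (hU : E.marginal P v m x = U)
    (hR : deriv E.f (x 2) = R) (hU0 : U ≠ 0) (hαR : P.α (x m) * R = 1)
    (hvU : deriv v (E.Fk x) = U * R)
    (hδ : δ = deriv P.α (x m) / P.α (x m))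
    (hω : ω = δ - (deriv (deriv P.u) (x m) + deriv (deriv P.α) (x m) * v (E.Fk x)) / U)
    (hη : η = δ * (R - 1) + deriv (deriv E.f) (x 2) / R)
    (h k : State) (hk : k 2 = R * h 2 - h 0 - h 1) :
    fderiv ℝ (E.eulerResidual P v m) (x, x) (h, k) =
      -U * (ω * h m + (δ - ω) * k m - δ * (k 0 + k 1) + η * k 2) := by
  have hM := E.hasFDerivAt_marginal (P := P) hx hm (hv.differentiableAt one_ne_zero)
  rw [hR, hvU] at hM
  set W := deriv (deriv P.u) (x m) + deriv (deriv P.α) (x m) * v (E.Fk x) with hW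
  have h1 := HasFDerivAt.comp (g := E.marginal P v m) (x, x) hM
    (hasFDerivAt_fst (𝕜 := ℝ) (p := (x, x)))
  have h2 := HasFDerivAt.comp (g := E.marginal P v m) (x, x) hM
    (hasFDerivAt_snd (𝕜 := ℝ) (p := (x, x)))
  have h3 := HasDerivAt.comp_hasFDerivAt (h₂ := P.α) (x, x) (P.hasDerivAt_α hm)
    (HasFDerivAt.comp (g := fun y : State => y m) (x, x) (hasFDerivAt_apply m x)
      (hasFDerivAt_fst (𝕜 := ℝ) (p := (x, x))))
  have h4 := HasDerivAt.comp_hasFDerivAt (h₂ := deriv E.f) (x, x)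
    ((E.contDiffAt_deriv_f hx).differentiableAt one_ne_zero).hasDerivAt
    (HasFDerivAt.comp (g := fun y : State => y 2) (x, x) (hasFDerivAt_apply 2 x)
      (hasFDerivAt_snd (𝕜 := ℝ) (p := (x, x))))
  have hd : HasFDerivAt (E.eulerResidual P v m) _ (x, x) := h1.sub ((h3.mul h2).mul h4)
  have hR0 : R ≠ 0 := right_ne_zero_of_mul_eq_one hαR
  have hα : P.α (x m) = R⁻¹ := eq_inv_of_mul_eq_one_left hαR
  rw [hd.fderiv]
  simp only [Function.comp_apply, sub_apply, add_apply,
    ContinuousLinearMap.comp_apply, smul_apply, ContinuousLinearMap.coe_fst',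
    ContinuousLinearMap.coe_snd', ContinuousLinearMap.proj_apply, dFk_apply, smul_eq_mul, hU, hR,
    Pi.mul_apply]
  -- Once `α'`, `W` and `f''` are expressed through `δ`, `ω`, `η`, `U` and `R`, all terms in `k 2`
  -- collect into `-U η k 2`.
  have hα' : deriv P.α (x m) = δ * R⁻¹ := by
    rw [hδ, hα]
    field_simp
  have hW' : W = U * (δ - ω) := by
    rw [hω]
    field_simp
    ring
  have hf'' : deriv (deriv E.f) (x 2) = R * (η - δ * (R - 1)) := by
    rw [hη]
    field_simp
    ring
  rw [hα', hα, hW', hf'']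
  rw [hk]
  field_simp
  ring

end Economy

end Capital

end

/-! ### The implicit map and the signs at the stationary state -/

namespace Capital

/-- The implicit function theorem for a relation `R (x, y) = 0` near a fixed point. -/
theorem exists_implicit_map {R : State × State → State} {p : State} (hR : ContDiffAt ℝ 1 R (p, p))
    (hR0 : R (p, p) = 0) (hinj : ∀ k, fderiv ℝ R (p, p) (0, k) = 0 → k = 0) :
    ∃ ψ : State → State, ψ p = p ∧ ContDiffAt ℝ 1 ψ p ∧ (∀ᶠ x in 𝓝 p, R (x, ψ x) = 0) ∧
      ∀ Φ : State → State, Φ p = p → ContinuousAt Φ p → (∀ᶠ x in 𝓝 p, R (x, Φ x) = 0) →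
        Φ =ᶠ[𝓝 p] ψ := by
  set A : State →L[ℝ] State := fderiv ℝ R (p, p) ∘L .inr ℝ State State with hA
  have hker : A.ker = ⊥ := LinearMap.ker_eq_bot'.2 hinj
  have hrange : A.range = ⊤ :=
    LinearMap.range_eq_top.2 (LinearMap.injective_iff_surjective.1 (LinearMap.ker_eq_bot.1 hker))
  have hinv : A.IsInvertible := ⟨ContinuousLinearEquiv.ofBijective A hker hrange,
    ContinuousLinearEquiv.coe_ofBijective A hker hrange⟩
  refine ⟨hR.implicitFunction one_ne_zero hinv, hR.implicitFunction_apply_self one_ne_zero hinv,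
    hR.contDiffAt_implicitFunction one_ne_zero hinv, ?_, fun Φ hp hc hΦ => ?_⟩
  · simpa only [hR0] using hR.eventually_apply_implicitFunction one_ne_zero hinv
  -- Continuity of `Φ` at `p` keeps `(x, Φ x)` near `(p, p)`, where the implicit function gives the
  -- only solution.
  · have ht : Tendsto (fun x => (x, Φ x)) (𝓝 p) (𝓝 (p, p)) := by
      have : ContinuousAt (fun x => (x, Φ x)) p := continuousAt_id.prodMk hc
      rwa [ContinuousAt, hp] at this
    filter_upwards [hΦ,
      ht.eventually (hR.eventually_apply_eq_iff_implicitFunction one_ne_zero hinv)] with x h1 h2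
    rw [hR0] at h2
    exact (h2.1 h1).symm

/-- Chain rule along the graph of `Φ`, on which `R` vanishes. This transfers the linearized
conditions to the derivative of any equilibrium map. -/
theorem fderiv_apply_of_eventually_eq_zero {R : State × State → State} {p : State}
    (hR : ContDiffAt ℝ 1 R (p, p)) {Φ : State → State} (hΦ : DifferentiableAt ℝ Φ p)
    (hp : Φ p = p) (h0 : ∀ᶠ x in 𝓝 p, R (x, Φ x) = 0) (h : State) :
    fderiv ℝ R (p, p) (h, fderiv ℝ Φ p h) = 0 := by
  have h1 : HasFDerivAt R (fderiv ℝ R (p, p)) (p, Φ p) := by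
    rw [hp]
    exact (hR.differentiableAt one_ne_zero).hasFDerivAt
  have h2 := h1.comp p ((hasFDerivAt_id (𝕜 := ℝ) p).prodMk hΦ.hasFDerivAt)
  have h3 : HasFDerivAt (fun x => R (x, Φ x)) (0 : State →L[ℝ] State) p :=
    (hasFDerivAt_const (0 : State) p).congr_of_eventuallyEq h0
  exact DFunLike.congr_fun (h2.unique h3) h

namespace Economy

variable {E : Economy}

/-- First order conditions and signs for one agent at a stationary equilibrium. -/
theorem agent_facts {P : Preferences} {m : Fin 3} {d : ℝ} {x : State} (hx : 0 < x 2) (hm : 0 < x m)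
    (hd : 0 < d) (hstat : x 2 = E.f (x 2) - d - x m) (hF : E.Fk x = x 2)
    (hopt : ∀ c', IsFeasible E.f (fun _ => d) (x 2) c' →
      prospectiveUtility P c' ≤ prospectiveUtility P (fun _ => x m))
    (hv : DifferentiableAt ℝ (valueFn P E.f d) (x 2)) :
    0 < E.marginal P (valueFn P E.f d) m x ∧ P.α (x m) * deriv E.f (x 2) = 1 ∧
    deriv (valueFn P E.f d) (E.Fk x) =
      E.marginal P (valueFn P E.f d) m x * deriv E.f (x 2) ∧
    1 < deriv E.f (x 2) ∧ 0 < deriv P.α (x m) / P.α (x m) ∧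
    deriv P.α (x m) / P.α (x m) < deriv P.α (x m) / P.α (x m) -
      (deriv (deriv P.u) (x m) + deriv (deriv P.α) (x m) * valueFn P E.f d (E.Fk x)) /
        E.marginal P (valueFn P E.f d) m x := by
  obtain ⟨h1, h2⟩ := E.first_order_conditions P hd hm hx hstat hopt hv
  have hv0 : 0 ≤ valueFn P E.f d (x 2) := E.valueFn_nonneg P d (x 2)
  have hα := P.α_pos hm.le
  have hα' := P.α_deriv_pos _ hm
  have hUdef : E.marginal P (valueFn P E.f d) m x =
      deriv P.u (x m) + deriv P.α (x m) * valueFn P E.f d (x 2) := by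
    rw [marginal, hF]
  have hU : 0 < deriv P.u (x m) + deriv P.α (x m) * valueFn P E.f d (x 2) :=
    add_pos_of_pos_of_nonneg (P.u_deriv_pos _ hm) (mul_nonneg hα'.le hv0)
  have hW : deriv (deriv P.u) (x m) + deriv (deriv P.α) (x m) * valueFn P E.f d (x 2) < 0 :=
    add_neg_of_neg_of_nonpos (P.u_deriv2_neg _ hm)
      (mul_nonpos_of_nonpos_of_nonneg (P.α_deriv2_neg _ hm).le hv0)
  -- Substituting `v' = U f'` into `U = α v'` and cancelling `U > 0`.
  have hαR : P.α (x m) * deriv E.f (x 2) = 1 := by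
    rw [h2] at h1
    exact mul_left_cancel₀ hU.ne' (by linear_combination -h1)
  have hα1 : P.α (x m) < 1 := by
    obtain ⟨s, -, hs1, hs⟩ := P.exists_α_le
    exact (hs _ hm.le).trans_lt hs1
  rw [hUdef, hF]
  refine ⟨hU, hαR, h2, ?_, div_pos hα' hα, ?_⟩
  · have hR := E.f_deriv_pos _ hx
    nlinarith
  · have := div_neg_of_neg_of_pos hW hU
    linarith

end Economy

end Capital

/-! ### The equilibrium conditions as one equation, and their linearization -/

noncomputable section

namespace Capital

namespace Economy

variable {E : Economy} {xb : State}

/-- The equilibrium conditions between `z.1` and `z.2`, as an equation. -/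
def residual (E : Economy) (xb : State) (z : State × State) : State :=
  ![E.eulerResidual E.prefI (E.vI xb) 0 z, E.eulerResidual E.prefJ (E.vJ xb) 1 z,
    z.2 2 - E.Fk z.1]

theorem equilibriumStep_iff {x y : State} :
    E.EquilibriumStep xb x y ↔ E.residual xb (x, y) = 0 := by
  rw [funext_iff, Fin.forall_fin_succ, Fin.forall_fin_two]
  exact (and_congr sub_eq_zero (and_congr sub_eq_zero sub_eq_zero)).symm

theorem IsStationaryEquilibrium.Fk_eq (hxb : E.IsStationaryEquilibrium xb) : E.Fk xb = xb 2 :=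
  hxb.2.1.symm

theorem contDiffAt_residual (hxb : E.IsStationaryEquilibrium xb)
    (hvI : ContDiffAt ℝ 1 (E.vI xb) (xb 2)) (hvJ : ContDiffAt ℝ 1 (E.vJ xb) (xb 2)) :
    ContDiffAt ℝ 1 (E.residual xb) (xb, xb) := by
  rw [← hxb.Fk_eq] at hvI hvJ
  rw [contDiffAt_pi, Fin.forall_fin_succ, Fin.forall_fin_two]
  refine ⟨E.contDiffAt_eulerResidual (hxb.1 2) (hxb.1 0) hvI,
    E.contDiffAt_eulerResidual (hxb.1 2) (hxb.1 1) hvJ, ?_⟩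
  have h1 : ContDiffAt ℝ 1 (fun z : State × State => E.Fk z.1) (xb, xb) :=
    ContDiffAt.comp (g := E.Fk) (xb, xb) (E.contDiffAt_Fk (hxb.1 2)) contDiffAt_fst
  have h2 : ContDiffAt ℝ 1 (fun z : State × State => z.2 2) (xb, xb) := by fun_prop
  exact h2.sub h1

theorem IsStationaryEquilibrium.factsI (hxb : E.IsStationaryEquilibrium xb)
    (hvI : ContDiffAt ℝ 1 (E.vI xb) (xb 2)) :
    0 < E.UI xb xb ∧ E.prefI.α (xb 0) * deriv E.f (xb 2) = 1 ∧
    deriv (E.vI xb) (E.Fk xb) = E.UI xb xb * deriv E.f (xb 2) ∧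
    1 < deriv E.f (xb 2) ∧ 0 < E.δI xb ∧ E.δI xb < E.ωI xb :=
  agent_facts (P := E.prefI) (m := 0) (hxb.1 2) (hxb.1 0) (hxb.1 1) (by linarith [hxb.2.1])
    hxb.Fk_eq hxb.2.2.1.2 (hvI.differentiableAt one_ne_zero)

theorem IsStationaryEquilibrium.factsJ (hxb : E.IsStationaryEquilibrium xb)
    (hvJ : ContDiffAt ℝ 1 (E.vJ xb) (xb 2)) :
    0 < E.UJ xb xb ∧ E.prefJ.α (xb 1) * deriv E.f (xb 2) = 1 ∧
    deriv (E.vJ xb) (E.Fk xb) = E.UJ xb xb * deriv E.f (xb 2) ∧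
    1 < deriv E.f (xb 2) ∧ 0 < E.δJ xb ∧ E.δJ xb < E.ωJ xb :=
  agent_facts (P := E.prefJ) (m := 1) (hxb.1 2) (hxb.1 1) (hxb.1 0) hxb.2.1
    hxb.Fk_eq hxb.2.2.2.2 (hvJ.differentiableAt one_ne_zero)

/-- At a stationary state each Euler equation reduces to `α f' = 1`. -/
theorem residual_self (hxb : E.IsStationaryEquilibrium xb)
    (hvI : ContDiffAt ℝ 1 (E.vI xb) (xb 2)) (hvJ : ContDiffAt ℝ 1 (E.vJ xb) (xb 2)) :
    E.residual xb (xb, xb) = 0 := by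
  obtain ⟨-, hI, -⟩ := hxb.factsI hvI
  obtain ⟨-, hJ, -⟩ := hxb.factsJ hvJ
  refine equilibriumStep_iff.1 ⟨?_, ?_, hxb.Fk_eq.symm⟩
  · linear_combination -E.UI xb xb * hI
  · linear_combination -E.UJ xb xb * hJ

/-- The kernel of the derivative of the equilibrium conditions. -/
theorem linearized_conditions (hxb : E.IsStationaryEquilibrium xb)
    (hvI : ContDiffAt ℝ 1 (E.vI xb) (xb 2)) (hvJ : ContDiffAt ℝ 1 (E.vJ xb) (xb 2))
    {h k : State} (h0 : fderiv ℝ (E.residual xb) (xb, xb) (h, k) = 0) :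
    E.ωI xb * k 0 + E.δI xb * k 1 = E.ωI xb * h 0 + E.ηI xb * k 2 ∧
    E.δJ xb * k 0 + E.ωJ xb * k 1 = E.ωJ xb * h 1 + E.ηJ xb * k 2 ∧
    k 2 = deriv E.f (xb 2) * h 2 - h 0 - h 1 := by
  have hd := (contDiffAt_residual hxb hvI hvJ).differentiableAt one_ne_zero
  have hcomp (m : Fin 3) : fderiv ℝ (fun z => E.residual xb z m) (xb, xb) (h, k) = 0 := by
    have := (hasFDerivAt_pi'.1 hd.hasFDerivAt m).fderiv
    rw [this, ContinuousLinearMap.comp_apply, h0]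
    rfl
  obtain ⟨hUI, hαI, hvI', -⟩ := hxb.factsI hvI
  obtain ⟨hUJ, hαJ, hvJ', -⟩ := hxb.factsJ hvJ
  -- The capital equation comes first: the derivatives of the Euler residuals are simplified with
  -- it.
  have h2 : k 2 = deriv E.f (xb 2) * h 2 - h 0 - h 1 := by
    have hF := HasFDerivAt.comp (g := E.Fk) (xb, xb) (E.hasFDerivAt_Fk (hxb.1 2))
      (hasFDerivAt_fst (𝕜 := ℝ) (p := (xb, xb)))
    have hk := HasFDerivAt.comp (g := fun y : State => y 2) (xb, xb) (hasFDerivAt_apply 2 xb)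
      (hasFDerivAt_snd (𝕜 := ℝ) (p := (xb, xb)))
    have e : HasFDerivAt (fun z => E.residual xb z 2) _ (xb, xb) := hk.sub hF
    have e2 := hcomp 2
    rw [e.fderiv] at e2
    exact sub_eq_zero.1 e2
  rw [← hxb.Fk_eq] at hvI hvJ
  have e0 := E.fderiv_eulerResidual (P := E.prefI) (v := E.vI xb) (m := 0) (U := E.UI xb xb)
    (δ := E.δI xb) (ω := E.ωI xb) (η := E.ηI xb)
    (hxb.1 2) (hxb.1 0) hvI rfl rfl hUI.ne' hαI hvI' rfl rfl rfl h k h2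
  have e1 := E.fderiv_eulerResidual (P := E.prefJ) (v := E.vJ xb) (m := 1) (U := E.UJ xb xb)
    (δ := E.δJ xb) (ω := E.ωJ xb) (η := E.ηJ xb)
    (hxb.1 2) (hxb.1 1) hvJ rfl rfl hUJ.ne' hαJ hvJ' rfl rfl rfl h k h2
  have c0 : fderiv ℝ (E.eulerResidual E.prefI (E.vI xb) 0) (xb, xb) (h, k) = 0 := hcomp 0
  have c1 : fderiv ℝ (E.eulerResidual E.prefJ (E.vJ xb) 1) (xb, xb) (h, k) = 0 := hcomp 1
  rw [c0, eq_comm, mul_eq_zero] at e0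
  rw [c1, eq_comm, mul_eq_zero] at e1
  have f0 := e0.resolve_left (neg_ne_zero.2 hUI.ne')
  have f1 := e1.resolve_left (neg_ne_zero.2 hUJ.ne')
  exact ⟨by linear_combination -f0, by linear_combination -f1, h2⟩

/-- Feasibility holds in a neighborhood of a stationary equilibrium. -/
theorem IsStationaryEquilibrium.stateSpace_mem_nhds (hxb : E.IsStationaryEquilibrium xb) :
    E.stateSpace ∈ 𝓝 xb := by
  obtain ⟨hpos, hk, -⟩ := hxb
  have hc (m : Fin 3) : ContinuousAt (fun x : State => x m) xb := (continuous_apply m).continuousAt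
  have hf : ContinuousAt (fun x : State => E.f (x 2)) xb :=
    ContinuousAt.comp (g := E.f) (E.hasDerivAt_f (hpos 2)).continuousAt (hc 2)
  have h0 := (hc 0).eventually_const_lt (hpos 0)
  have h1 := (hc 1).eventually_const_lt (hpos 1)
  have h2 := (hc 2).eventually_const_lt (hpos 2)
  -- Both inequalities are strict at `xb`, since `f(k) = k + cⁱ + cʲ` with positive terms.
  have h3 := (hc 2).eventually_lt hf (by linarith [hpos 0, hpos 1])
  have h4 := ((hc 0).add (hc 1)).eventually_lt hf
    (show xb 0 + xb 1 < E.f (xb 2) by linarith [hpos 2])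
  filter_upwards [h0, h1, h2, h3, h4] with x a0 a1 a2 a3 a4
  exact ⟨a0.le, a1.le, a2.le, a3.le, a4.le⟩

end Economy

/-! ### The stable curve as a graph over capital -/

namespace LinearizedStep

variable {D : State →ₗ[ℝ] State} {ωi ωj δi δj ηi ηj R : ℝ}

open Polynomial in
/-- The linear equations of the stable manifold of the linearized equilibrium map, with the capital
stock as coordinate. -/
theorem exists_unique_stable_orbit (hD : LinearizedStep D ωi ωj δi δj ηi ηj R) (hδi : 0 < δi)
    (hωi : δi < ωi) {a b c l₁ : ℝ} {l₂ l₃ : ℂ}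
    (hchar : (LinearMap.toMatrix' D).charpoly = X ^ 3 + C a * X ^ 2 + C b * X + C c)
    (h0 : 0 < l₁) (h1 : l₁ < 1) (h2 : 1 < ‖l₂‖) (h3 : 1 < ‖l₃‖)
    (ha : (a : ℂ) = -(l₁ + l₂ + l₃)) (hb : (b : ℂ) = l₁ * l₂ + l₁ * l₃ + l₂ * l₃)
    (hc : (c : ℂ) = -(l₁ * l₂ * l₃)) :
    (∀ (s : ℝ) (g : ℕ → State), Tendsto g atTop (𝓝 0) → ∃ h : ℕ → State,
      Tendsto h atTop (𝓝 0) ∧ h 0 2 = s ∧ ∀ t, h (t + 1) = D (h t) + g t) ∧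
    (∀ h : ℕ → State, Tendsto h atTop (𝓝 0) → (∀ t, h (t + 1) = D (h t)) → h 0 2 = 0 →
      h 0 = 0) := by
  have hcub := cubic_apply_eq_zero hchar
  constructor
  · intro s g hg
    have hl1 : ‖(l₁ : ℂ)‖ ≠ 1 := by
      rw [Complex.norm_real, Real.norm_of_nonneg h0.le]
      exact h1.ne
    obtain ⟨h, hh, e⟩ := exists_tendsto_zero_orbit D hcub ha hb hc hl1 h2.ne' h3.ne' hg
    have hroot : (LinearMap.toMatrix' D).charpoly.IsRoot l₁ := by
      rw [hchar]
      simp only [IsRoot.def, eval_add, eval_mul, eval_pow, eval_X, eval_C]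
      have : (l₁ : ℂ) ^ 3 + a * l₁ ^ 2 + b * l₁ + c = 0 := by
        rw [ha, hb, hc]
        ring
      exact_mod_cast this
    obtain ⟨v, hv0, hv⟩ := exists_eigenvector_of_isRoot hroot
    have hv2 : v 2 ≠ 0 := fun hv2 => hv0 (hD.eq_zero_of_eigenvector hδi hωi h0 h1 hv hv2)
    -- A decaying multiple of the stable eigenvector `v` corrects the initial capital to `s`; this
    -- is possible because `v 2 ≠ 0`.
    refine ⟨fun t => h t + (l₁ ^ t * ((s - h 0 2) / v 2)) • v, ?_, ?_, fun t => ?_⟩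
    · have := (((tendsto_pow_atTop_nhds_zero_of_lt_one h0.le h1).mul_const
        ((s - h 0 2) / v 2)).smul_const v)
      simpa using hh.add this
    · simp only [pow_zero, one_mul, Pi.add_apply, Pi.smul_apply, smul_eq_mul]
      rw [div_mul_cancel₀ _ hv2]
      ring
    · simp only [map_add, map_smul, hv, e, smul_smul, pow_succ]
      rw [show l₁ ^ t * l₁ * ((s - h 0 2) / v 2) = l₁ ^ t * ((s - h 0 2) / v 2) * l₁ by ring]
      abel
  · intro h hh e hs
    exact hD.eq_zero_of_eigenvector hδi hωi h0 h1
      (map_eq_smul_of_tendsto_zero D hcub ha hb hc h2 h3 hh e) hs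

end LinearizedStep

/-- The defining function of a curve `γ` parametrized by the capital stock. -/
def graphFn (γ : ℝ → State) (x : State) : Fin 2 → ℝ :=
  fun m => x m.castSucc - γ (x 2) m.castSucc

theorem eq_of_graphFn_eq_zero {γ : ℝ → State} {x : State} (h : graphFn γ x = 0)
    (hγ : γ (x 2) 2 = x 2) : x = γ (x 2) := by
  ext m
  refine Fin.lastCases hγ.symm (fun m => ?_) m
  exact sub_eq_zero.1 (congrFun h m)

theorem contDiffAt_graphFn {γ : ℝ → State} {x : State} (hγ : ContDiffAt ℝ 1 γ (x 2)) :
    ContDiffAt ℝ 1 (graphFn γ) x := by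
  refine contDiffAt_pi.2 fun m => ?_
  have h1 : ContDiffAt ℝ 1 (fun x : State => γ (x 2)) x :=
    ContDiffAt.comp (g := γ) x hγ (contDiff_apply ℝ ℝ 2).contDiffAt
  exact (contDiff_apply ℝ ℝ m.castSucc).contDiffAt.sub (contDiffAt_pi.1 h1 m.castSucc)

/-- The curve depends on capital alone, so varying consumption moves only the first term of
`graphFn`. -/
theorem fderiv_graphFn_single {γ : ℝ → State} {x : State} (hγ : ContDiffAt ℝ 1 γ (x 2))
    (l m : Fin 2) :
    fderiv ℝ (graphFn γ) x (Pi.single m.castSucc 1) l = (1 : Matrix (Fin 2) (Fin 2) ℝ) l m := by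
  have h1 : HasFDerivAt (fun x : State => γ (x 2)) _ x :=
    HasFDerivAt.comp (g := γ) x (hγ.differentiableAt one_ne_zero).hasFDerivAt
      (hasFDerivAt_apply 2 x)
  have h2 := (hasFDerivAt_apply (𝕜 := ℝ) (F' := fun _ : Fin 3 => ℝ) l.castSucc x).sub
    (hasFDerivAt_pi'.1 h1 l.castSucc)
  have h3 := hasFDerivAt_pi'.1
    ((contDiffAt_graphFn hγ).differentiableAt one_ne_zero).hasFDerivAt l
  have h4 := DFunLike.congr_fun (h3.unique h2) (Pi.single m.castSucc 1)
  refine h4.trans ?_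
  have h5 : (Pi.single m.castSucc 1 : State) 2 = 0 :=
    Pi.single_eq_of_ne (Fin.castSucc_lt_last m).ne' _
  have h6 : (Pi.single m.castSucc 1 : State) l.castSucc =
      (1 : Matrix (Fin 2) (Fin 2) ℝ) l m := by
    rw [Matrix.one_apply, Pi.single_apply]
    simp
  change (Pi.single m.castSucc 1 : State) l.castSucc -
    fderiv ℝ γ (x 2) ((Pi.single m.castSucc 1 : State) 2) l.castSucc = _
  rw [h5, map_zero, h6]
  exact sub_zero _

theorem surjective_of_fderiv_single {L : State →L[ℝ] (Fin 2 → ℝ)}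
    (hL : ∀ l m : Fin 2, L (Pi.single m.castSucc 1) l = (1 : Matrix (Fin 2) (Fin 2) ℝ) l m) :
    Function.Surjective L := by
  intro y
  refine ⟨∑ m : Fin 2, y m • Pi.single m.castSucc 1, ?_⟩
  ext l
  rw [map_sum, Finset.sum_apply]
  simp only [map_smul, Pi.smul_apply, hL, smul_eq_mul, Matrix.one_apply, mul_ite, mul_one, mul_zero]
  simp

end Capital

end

/-! ### Proof of the theorem -/

theorem mainTheorem2 (E : Capital.Economy) (xb : Capital.State)
    (hxb : E.IsStationaryEquilibrium xb)
    (hvI : ContDiffAt ℝ 1 (E.vI xb) (xb 2)) (hvJ : ContDiffAt ℝ 1 (E.vJ xb) (xb 2))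
    (hP1 : E.ηI xb < 0 ∧ E.ηJ xb < 0)
    (hP2 : E.δI xb ≤ E.δJ xb)
    (hP3 : 0 ≤ deriv E.f (xb 2) - (2 * E.ωI xb * E.ωJ xb + (E.δI xb - E.ωI xb) * E.ηJ xb
      + E.ηI xb * (E.δJ xb - E.ωJ xb))) :
    (∃ Φ, E.IsEquilibriumMap xb Φ) ∧
    ∀ Φ : Capital.State → Capital.State, E.IsEquilibriumMap xb Φ →
      ContDiffAt ℝ 1 Φ xb ∧
      Capital.IsHyperbolicFixedPoint Φ xb ∧
      (∃ (l₁ : ℝ) (l₂ l₃ : ℂ), 0 < l₁ ∧ l₁ < 1 ∧ 1 < ‖l₂‖ ∧ 1 < ‖l₃‖ ∧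
        ((Capital.jacobian Φ xb).map (algebraMap ℝ ℂ)).charpoly.roots = {(l₁ : ℂ), l₂, l₃}) ∧
      ((Capital.jacobian Φ xb).charpoly.Splits →
        ∃ l₁ l₂ l₃ : ℝ, 0 < l₁ ∧ l₁ < 1 ∧ 1 < l₂ ∧ l₂ ≤ l₃ ∧
          (Capital.jacobian Φ xb).charpoly.roots = {l₁, l₂, l₃} ∧
          ((Capital.jacobian Φ xb).charpoly.Separable → l₂ < l₃)) ∧
      ∃ (N : Set Capital.State) (φ : Capital.State → Fin 2 → ℝ),
        IsOpen N ∧ xb ∈ N ∧ ContDiffOn ℝ 1 φ N ∧ φ xb = 0 ∧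
        Function.Surjective (fderiv ℝ φ xb) ∧
        (Capital.consumptionJacobian φ xb).det ≠ 0 ∧
        (∀ x : ℕ → Capital.State, E.IsEquilibriumPath xb Φ x → x 0 ∈ N → φ (x 0) = 0 →
          Tendsto x atTop (𝓝 xb)) ∧
        (∀ x₀ ∈ N, φ x₀ = 0 → E.IsEquilibriumPath xb Φ (fun t => Φ^[t] x₀)) := by
  obtain ⟨-, -, -, hR, hδi, hωi⟩ := hxb.factsI hvI
  obtain ⟨-, -, -, -, hδj, hωj⟩ := hxb.factsJ hvJ
  have hres := Capital.Economy.contDiffAt_residual hxb hvI hvJ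
  have hself := Capital.Economy.residual_self hxb hvI hvJ
  obtain ⟨ψ, hψ0, hψc, hψ, huniq⟩ := Capital.exists_implicit_map hres hself (by
    intro k hk
    obtain ⟨e0, e1, e2⟩ := Capital.Economy.linearized_conditions hxb hvI hvJ hk
    simp only [Pi.zero_apply, mul_zero, sub_zero] at e2
    simp only [e2, Pi.zero_apply, mul_zero, add_zero] at e0 e1
    -- With today's state fixed, tomorrow's capital does not vary, and tomorrow's consumptions solve
    -- a homogeneous system with this determinant.
    have hdet : 0 < E.ωI xb * E.ωJ xb - E.δI xb * E.δJ xb := by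
      have := mul_lt_mul'' hωi hωj hδi.le hδj.le
      linarith
    have k0 : k 0 = 0 := (mul_eq_zero.1 (show
      (E.ωI xb * E.ωJ xb - E.δI xb * E.δJ xb) * k 0 = 0 by
        linear_combination E.ωJ xb * e0 - E.δI xb * e1)).resolve_left hdet.ne'
    have k1 : k 1 = 0 := (mul_eq_zero.1 (show
      (E.ωI xb * E.ωJ xb - E.δI xb * E.δJ xb) * k 1 = 0 by
        linear_combination E.ωI xb * e1 - E.δJ xb * e0)).resolve_left hdet.ne'
    ext m
    fin_cases m
    exacts [k0, k1, e2])
  refine ⟨⟨ψ, hψ0, hψc.continuousAt, ?_⟩, fun Φ ⟨hΦ0, hΦc, hΦ⟩ => ?_⟩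
  · filter_upwards [hψ] with x hx using Capital.Economy.equilibriumStep_iff.2 hx
  have hΦr : ∀ᶠ x in 𝓝 xb, E.residual xb (x, Φ x) = 0 := by
    filter_upwards [hΦ] with x hx using Capital.Economy.equilibriumStep_iff.1 hx
  have hΦ1 : ContDiffAt ℝ 1 Φ xb := hψc.congr_of_eventuallyEq (huniq Φ hΦ0 hΦc hΦr)
  have hΦd : DifferentiableAt ℝ Φ xb := hΦ1.differentiableAt one_ne_zero
  have hlin (h : Capital.State) := Capital.Economy.linearized_conditions hxb hvI hvJ
    (Capital.fderiv_apply_of_eventually_eq_zero hres hΦd hΦ0 hΦr h)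
  have hD : Capital.LinearizedStep (fderiv ℝ Φ xb : Capital.State →ₗ[ℝ] Capital.State) (E.ωI xb)
      (E.ωJ xb) (E.δI xb) (E.δJ xb) (E.ηI xb) (E.ηJ xb) (deriv E.f (xb 2)) :=
    ⟨fun h => (hlin h).1, fun h => (hlin h).2.1, fun h => (hlin h).2.2⟩
  obtain ⟨a, b, c, l₁, l₂, l₃, hchar, h0, h1, h2, h3, ha, hb, hc, hreal⟩ :=
    hD.exists_roots hδi hδj hωi hωj hP1.1 hP1.2 hR
  have hroots := Capital.roots_charpoly_map (J := Capital.jacobian Φ xb) hchar ha hb hc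
  refine ⟨hΦ1, ⟨hΦ0, hΦd, fun z hz => ?_⟩, ⟨l₁, l₂, l₃, h0, h1, h2, h3, hroots⟩,
    Capital.exists_ordered_roots hroots h0 h1 hreal, ?_⟩
  · rw [Matrix.mem_spectrum_iff_isRoot_charpoly,
      ← Polynomial.mem_roots (Matrix.charpoly_monic _).ne_zero, hroots] at hz
    simp only [Multiset.insert_eq_cons, Multiset.mem_cons, Multiset.mem_singleton] at hz
    rcases hz with rfl | rfl | rfl
    · rw [Complex.norm_real, Real.norm_of_nonneg h0.le]
      exact h1.ne
    · exact h2.ne'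
    · exact h3.ne'
  obtain ⟨hsurj, hinj⟩ := hD.exists_unique_stable_orbit hδi hωi hchar h0 h1 h2 h3 ha hb hc
  obtain ⟨γ, hγc, hγ0, hγ2, hγlim, hγU⟩ := Capital.exists_stable_curve hΦ1 hΦ0
    (ContinuousLinearMap.proj (R := ℝ) (φ := fun _ : Fin 3 => ℝ) 2) hsurj hinj
  -- All properties of `γ` hold on one open set `V` of capital stocks. The neighborhood `N`
  -- restricts capital only: `φ = 0` already puts a state on the curve.
  simp only [ContinuousLinearMap.proj_apply] at hγc hγ0 hγ2 hγlim hγU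
  obtain ⟨V, hV, hVo, hxV⟩ := eventually_nhds_iff.1
    ((hγc.eventually (by simp)).and (hγ2.and (hγlim.and
      (hγU _ (inter_mem hxb.stateSpace_mem_nhds hΦ)))))
  have hγ (x : Capital.State) (hx : x 2 ∈ V) (h : Capital.graphFn γ x = 0) : x = γ (x 2) :=
    Capital.eq_of_graphFn_eq_zero h (hV _ hx).2.1
  refine ⟨(fun x => x 2) ⁻¹' V, Capital.graphFn γ, hVo.preimage (continuous_apply 2), hxV,
    fun x hx => (Capital.contDiffAt_graphFn (hV _ hx).1).contDiffWithinAt, ?_,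
    Capital.surjective_of_fderiv_single (Capital.fderiv_graphFn_single hγc), ?_,
    fun x hx hxN hx0 => ?_, fun x hxN hx0 t => ?_⟩
  · ext m
    simp [Capital.graphFn, hγ0]
  · have : Capital.consumptionJacobian (Capital.graphFn γ) xb = 1 := by
      ext l m
      exact Capital.fderiv_graphFn_single hγc l m
    rw [this, Matrix.det_one]
    exact one_ne_zero
  · have hiter (t : ℕ) : x t = Φ^[t] (γ (x 0 2)) := by
      rw [← hγ (x 0) hxN hx0]
      induction t with
      | zero => rfl
      | succ t ih => rw [(hx t).2.1, ih, Function.iterate_succ_apply']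
    exact (hV _ hxN).2.2.1.congr fun t => (hiter t).symm
  -- `V` was chosen so that orbits from the curve stay where states are feasible and the equilibrium
  -- conditions hold.
  · have ht := (hV _ hxN).2.2.2 t
    rw [← hγ x hxN hx0] at ht
    refine ⟨ht.1, Function.iterate_succ_apply' _ _ _, ?_⟩
    simp only [Function.iterate_succ_apply']
    exact ht.2
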